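/- Let $S\subset\mathbb R^2$ be a compact convex set with non-empty interior whose boundary $\partial S$ is of class $C^3$, parametrized by arc length by a simple closed $C^3$ curve $\gamma$. The visibility domain $V_S$ is the set of pairs $(p,v)$ with $p\in\mathbb R^2\setminus\operatorname{int}S$ and $v$ a unit vector such that the ray $\{p+tv:t\ge 0\}$ meets $S$. The bouncing outer billiard map $F_S(p,v)=(p',v')$ is defined as follows. Let $w$ be the first point of $S$ on the ray. Reflect the ray at $w$ off $\partial S$ (angle of incidence equals angle of reflection), and let $p'$ be the point of the reflected ray with $\|p'-w\|=\|p-w\|$. Let $u$ be the unit vector at $p'$ opposite to the direction of the reflected ray (so it points to $w$), and let $v'$ be the mirror image of $u$ in the bisector of the angle formed by the two rays from $p'$ tangent to $S$. A point $x\in\partial S$ is a vertex if the curvature of $\partial S$ has a local minimum or a local maximum (not necessarily strict) at $x$. Let $I_x\subset\partial S$ be the largest line segment in $\partial S$ containing $x$; thus $I_x=\{x\}$ unless $x$ lies on a straight piece of the boundary. For $\varepsilon>0$, a local 1-parameter family of fixed points in the $\varepsilon$-neighbourhood of $I_x$ is a connected set $C\subset V_S$ of fixed points $(p,v)$ of $F_S$,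 with $p\notin S$ and $\operatorname{dist}(p,I_x)<\varepsilon$, for which there is $\delta>0$ such that for every $t\in(0,\delta)$ some $(p,v)\in C$ has $\operatorname{dist}(p,S)=t$. Theorem 2.1. (1) $F_S$ has uncountably many fixed points $(p,v)$ with $p\notin S$. (2) For every vertex $x$ of $\partial S$ and every $\varepsilon>0$ there is a local 1-parameter family of fixed points in the $\varepsilon$-neighbourhood of $I_x$. (3) There are four vertices $x_1,\dots,x_4$ of $\partial S$ with $I_{x_1},\dots,I_{x_4}$ pairwise disjoint; and for every $\varepsilon>0$ there are pairwise disjoint local 1-parameter families $C_1,\dots,C_4$ of fixed points with $C_i$ in the $\varepsilon$-neighbourhood of $I_{x_i}$. -/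

import Mathlib

open Set Metric
open scoped RealInnerProductSpace

noncomputable section

/-- The Euclidean plane. -/
abbrev Plane : Type := EuclideanSpace ℝ (Fin 2)

/-! ### The bouncing outer billiard map of a planar convex body `S` -/

/-- The mirror image of the vector `x` in the line through the origin orthogonal to `n ≠ 0`. -/
def mirror (n x : Plane) : Plane := (ℝ ∙ n)ᗮ.reflection x

/-- The visibility domain `V_S`: pairs `(p, v)` where `p` is not an interior point of `S` and `v` is
a unit vector at `p` whose ray meets `S`. -/
def visibilityDomain (S : Set Plane) : Set (Plane × Plane) :=
  {z | z.1 ∉ interior S ∧ ‖z.2‖ = 1 ∧ ∃ t : ℝ, 0 ≤ t ∧ z.1 + t • z.2 ∈ S}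

/-- The length travelled along the ray of `(p, v)` until `S` is hit for the first time. -/
def hitTime (S : Set Plane) (z : Plane × Plane) : ℝ :=
  sInf {t : ℝ | 0 ≤ t ∧ z.1 + t • z.2 ∈ S}

/-- The bounce point `w`. -/
def bouncePoint (S : Set Plane) (z : Plane × Plane) : Plane :=
  z.1 + hitTime S z • z.2

/-- `ν` is an outward unit normal of `S` at `w`. -/
def IsOuterNormal (S : Set Plane) (w ν : Plane) : Prop :=
  ‖ν‖ = 1 ∧ ∀ y ∈ S, ⟪y - w, ν⟫ ≤ 0

/-- The outward unit normal at a boundary point (unique when `S` is a convex body with `C¹`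
boundary). -/
def outerNormal (S : Set Plane) (w : Plane) : Plane :=
  Classical.epsilon (IsOuterNormal S w)

/-- The unit direction of the ray reflected at the bounce point (angle of incidence = angle of
reflection): the mirror image of `v` in the tangent line of `∂S` at `w`. -/
def bouncedDirection (S : Set Plane) (z : Plane × Plane) : Plane :=
  mirror (outerNormal S (bouncePoint S z)) z.2

/-- The point `p'` on the reflected ray with `‖p' - w‖ = ‖p - w‖`. -/
def newPoint (S : Set Plane) (z : Plane × Plane) : Plane :=
  bouncePoint S z + hitTime S z • bouncedDirection S z

/-- The ray from `p` in the unit direction `d` is tangent to `S`: it meets `S`, and the line that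
carries it is a supporting line of `S`. From a point outside a convex body there are exactly two
such rays. -/
def IsTangentDirection (S : Set Plane) (p d : Plane) : Prop :=
  ‖d‖ = 1 ∧ (∃ t : ℝ, 0 ≤ t ∧ p + t • d ∈ S) ∧
    ∃ ν : Plane, ‖ν‖ = 1 ∧ ⟪d, ν⟫ = 0 ∧ ∀ y ∈ S, ⟪y - p, ν⟫ ≤ 0

/-- The unit directions of the two tangent rays from `p` to `S`, in some order. -/
def tangentDirections (S : Set Plane) (p : Plane) : Plane × Plane :=
  Classical.epsilon fun d : Plane × Plane =>
    d.1 ≠ d.2 ∧ IsTangentDirection S p d.1 ∧ IsTangentDirection S p d.2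

/-- Reflection of vectors at `p` across the bisector of the angle between the two tangent rays from
`p` to `S`. For distinct unit vectors `d₁`, `d₂` of the plane, the line orthogonal to `d₁ - d₂` is
the bisector of the angle they form, so the order of the two directions is irrelevant. -/
def bisectorReflection (S : Set Plane) (p u : Plane) : Plane :=
  mirror ((tangentDirections S p).1 - (tangentDirections S p).2) u

/-- The bouncing outer billiard map `F_S (p, v) = (p', v')`. The unit vector `u` at `p'` that points
to `w` is opposite to the direction of the reflected ray, and `v'` is the mirror image of `u` across
the bisector of the angle under which `S` is seen from `p'`. -/
def bouncingOuterBilliard (S : Set Plane) (z : Plane × Plane) : Plane × Plane :=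
  (newPoint S z, bisectorReflection S (newPoint S z) (-bouncedDirection S z))

/-- The fixed points `(p, v)` of `F_S` whose base point `p` is outside `S`. (Over `∂S` the map is the
identity, so the fixed points there are of no interest.) -/
def exteriorFixedPoints (S : Set Plane) : Set (Plane × Plane) :=
  {z | z ∈ visibilityDomain S ∧ z.1 ∉ S ∧ bouncingOuterBilliard S z = z}

/-! ### `C³` boundary, curvature, vertices -/

/-- `γ` is an arc-length parametrization of class `C³` of `∂S`, which is a simple closed curve of
length `L`. -/
structure IsArcLengthBoundary (S : Set Plane) (L : ℝ) (γ : ℝ → Plane) : Prop where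
  length_pos : 0 < L
  contDiff : ContDiff ℝ 3 γ
  unit_speed : ∀ s, ‖deriv γ s‖ = 1
  periodic : Function.Periodic γ L
  injOn : InjOn γ (Ico 0 L)
  range_eq : range γ = frontier S

/-- The curvature at `γ s` of a curve `γ` parametrized by arc length. (The boundary of a convex body
always turns the same way, so no sign is needed.) -/
def curvature (γ : ℝ → Plane) (s : ℝ) : ℝ := ‖deriv (deriv γ) s‖

/-- `γ s` is a vertex: the curvature has a local minimum or a local maximum there. -/
def IsVertex (γ : ℝ → Plane) (s : ℝ) : Prop := IsLocalExtr (curvature γ) s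

/-- The maximal line segment in `∂S` through the boundary point `x`. It is `{x}` unless `x` lies on a
straight piece of the boundary; in particular it is `{x}` when the curvature at `x` is positive. -/
def flatPiece (S : Set Plane) (x : Plane) : Set Plane :=
  {y | segment ℝ x y ⊆ frontier S}

/-- `C` is a local one-parameter family of fixed points of `F_S` inside the region `U`: a connected
set of fixed points `(p, v)` with `p ∈ U \ S`, in which the distance from `p` to `S` runs through
all sufficiently small positive values. -/
def IsLocalFixedFamily (S U : Set Plane) (C : Set (Plane × Plane)) : Prop :=
  C ⊆ exteriorFixedPoints S ∧ (∀ z ∈ C, z.1 ∈ U) ∧ IsConnected C ∧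
    ∃ δ : ℝ, 0 < δ ∧ ∀ t ∈ Ioo 0 δ, ∃ z ∈ C, infDist z.1 S = t

end

/-!
A point `p = γ s + t • ν s` on an outward normal shoots along `-ν s`, is bounced straight back, and
`(p, -ν s)` is fixed by `F_S` exactly when the normal bisects the angle under which `S` is seen from
`p`, that is, when `S` rises to the same slope on both sides of the normal. Expanding to third
order, the difference of these two slopes for small `t` has the sign of `-κ'(s)`, so it changes sign
across a vertex, and the points where it vanishes contain a connected set joining the boundary to a
fixed distance from it: otherwise the zeros would split into an upper and a lower part, and crossing
the strip between the two would contradict the Poincaré–Miranda theorem. On a circular arc the two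
slopes agree by symmetry, and a flat arc plays the role of a single point.

If the curvature had fewer than four extrema on disjoint flat pieces, its monotone arcs would be
separated by a chord, and integrating `κ'` against the affine function vanishing on that chord would
contradict the closedness of the curve.
-/

noncomputable section

open Filter Topology Asymptotics

section Crossing

/-! ### Connected zero sets in a rectangle -/

lemma lt_of_cos_sub_pos {φ : ℝ → ℝ} {x y : ℝ} (α : ℝ) (hφ : ContinuousOn φ (uIcc x y))
    (hcos : ∀ t ∈ uIcc x y, 0 < Real.cos (φ t - α)) (hx : Real.sin (φ x - α) < 0)
    (hy : 0 < Real.sin (φ y - α)) : φ x < φ y := by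
  by_contra! hle
  have hpos : ∀ r ∈ Icc (φ y) (φ x), 0 < Real.cos (r - α) := by
    intro r hr
    obtain ⟨t, ht, rfl⟩ := intermediate_value_uIcc hφ (Icc_subset_uIcc' hr)
    exact hcos t ht
  have hmono : MonotoneOn (fun r => Real.sin (r - α)) (Icc (φ y) (φ x)) := by
    refine monotoneOn_of_hasDerivWithinAt_nonneg (convex_Icc _ _) (by fun_prop)
      (fun r _ => ((hasDerivAt_id r).sub_const α).sin.hasDerivWithinAt) fun r hr => ?_
    simpa using (hpos r (interior_subset hr)).le
  exact ((hx.trans hy).trans_le (hmono (left_mem_Icc.2 hle) (right_mem_Icc.2 hle) hle)).false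

lemma exists_continuous_polar_angle {X : Type*} [TopologicalSpace X] [SimplyConnectedSpace X]
    [LocallyPathConnectedSpace X] {g h : X → ℝ} (hg : Continuous g) (hh : Continuous h)
    (hgh : ∀ x, g x = 0 → h x ≠ 0) :
    ∃ r θ : X → ℝ, Continuous θ ∧ ∀ x, 0 < r x ∧ g x = r x * Real.cos (θ x) ∧
      h x = r x * Real.sin (θ x) := by
  let G : C(X, ℂ) := ⟨fun x => ⟨g x, h x⟩, by
    simpa only [Complex.mk_eq_add_mul_I] using by fun_prop⟩
  have hG : ∀ x, G x ≠ 0 := fun x hx =>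
    hgh x (congrArg Complex.re hx) (congrArg Complex.im hx)
  obtain ⟨x₀⟩ : Nonempty X := inferInstance
  obtain ⟨f, ⟨-, hf⟩, -⟩ :=
    Complex.isCoveringMapOn_exp.existsUnique_continuousMap_lifts G (Complex.exp_log (hG x₀)) hG
  refine ⟨fun x => Real.exp (f x).re, fun x => (f x).im, Complex.continuous_im.comp f.continuous,
    fun x => ⟨Real.exp_pos _, ?_, ?_⟩⟩
  · exact (congrArg Complex.re (congrFun hf x)).symm.trans (Complex.exp_re _)
  · exact (congrArg Complex.im (congrFun hf x)).symm.trans (Complex.exp_im _)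

lemma not_continuous_angle_of_edge_signs {a b c d : ℝ} (hab : a ≤ b) (hcd : c ≤ d) {θ : ℝ × ℝ → ℝ}
    (ha : ∀ t ∈ Icc c d, Real.cos (θ (a, t)) < 0) (hb : ∀ t ∈ Icc c d, 0 < Real.cos (θ (b, t)))
    (hc : ∀ s ∈ Icc a b, Real.sin (θ (s, c)) < 0) (hd : ∀ s ∈ Icc a b, 0 < Real.sin (θ (s, d))) :
    ¬ Continuous θ := by
  intro hθ
  rw [← uIcc_of_le hcd] at ha hb
  rw [← uIcc_of_le hab] at hc hd
  have right_edge : θ (b, c) < θ (b, d) :=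
    lt_of_cos_sub_pos (φ := fun t => θ (b, t)) 0 (by fun_prop) (by simpa using hb)
      (by simpa using hc b right_mem_uIcc) (by simpa using hd b right_mem_uIcc)
  have top_edge : θ (b, d) < θ (a, d) :=
    lt_of_cos_sub_pos (φ := fun s => θ (s, d)) (Real.pi / 2) (by fun_prop)
      (by simpa [uIcc_comm, Real.cos_sub_pi_div_two] using hd)
      (by simpa [Real.sin_sub_pi_div_two] using hb d right_mem_uIcc)
      (by simpa [Real.sin_sub_pi_div_two] using ha d right_mem_uIcc)
  have left_edge : θ (a, d) < θ (a, c) :=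
    lt_of_cos_sub_pos (φ := fun t => θ (a, t)) Real.pi (by fun_prop)
      (by simpa [uIcc_comm, Real.cos_sub_pi] using ha)
      (by simpa [Real.sin_sub_pi] using hd a left_mem_uIcc)
      (by simpa [Real.sin_sub_pi] using hc a left_mem_uIcc)
  have bottom_edge : θ (a, c) < θ (b, c) :=
    lt_of_cos_sub_pos (φ := fun s => θ (s, c)) (-(Real.pi / 2)) (by fun_prop)
      (by simpa [Real.cos_add_pi_div_two] using hc)
      (by simpa [Real.sin_add_pi_div_two] using ha c left_mem_uIcc)
      (by simpa [Real.sin_add_pi_div_two] using hb c left_mem_uIcc)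
  exact (right_edge.trans (top_edge.trans (left_edge.trans bottom_edge))).false

/-- The two-dimensional Poincaré–Miranda theorem. Without a common zero, the angle of `(g, h)` would
increase along each of the four edges, so it would not return to its initial value. -/
theorem exists_common_zero_rectangle {a b c d : ℝ} (hab : a ≤ b) (hcd : c ≤ d) {g h : ℝ × ℝ → ℝ}
    (hg : ContinuousOn g (Icc a b ×ˢ Icc c d)) (hh : ContinuousOn h (Icc a b ×ˢ Icc c d))
    (ga : ∀ t ∈ Icc c d, g (a, t) < 0) (gb : ∀ t ∈ Icc c d, 0 < g (b, t))
    (hc : ∀ s ∈ Icc a b, h (s, c) < 0) (hd : ∀ s ∈ Icc a b, 0 < h (s, d)) :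
    ∃ z ∈ Icc a b ×ˢ Icc c d, g z = 0 ∧ h z = 0 := by
  let clamp : ℝ × ℝ → ℝ × ℝ := fun z => (projIcc a b hab z.1, projIcc c d hcd z.2)
  have hclamp : Continuous clamp := by fun_prop
  have hclamp_mem : ∀ z, clamp z ∈ Icc a b ×ˢ Icc c d := fun z => ⟨Subtype.prop _, Subtype.prop _⟩
  have hclamp_eq : ∀ s ∈ Icc a b, ∀ t ∈ Icc c d, clamp (s, t) = (s, t) := fun s hs t ht => by
    simp only [clamp, projIcc_of_mem hab hs, projIcc_of_mem hcd ht]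
  by_contra! hne
  obtain ⟨r, θ, hθ, hpolar⟩ := exists_continuous_polar_angle (hg.comp_continuous hclamp hclamp_mem)
    (hh.comp_continuous hclamp hclamp_mem) fun z => hne _ (hclamp_mem z)
  have hg_polar : ∀ s ∈ Icc a b, ∀ t ∈ Icc c d, g (s, t) = r (s, t) * Real.cos (θ (s, t)) :=
    fun s hs t ht => by rw [← (hpolar (s, t)).2.1, Function.comp_apply, hclamp_eq s hs t ht]
  have hh_polar : ∀ s ∈ Icc a b, ∀ t ∈ Icc c d, h (s, t) = r (s, t) * Real.sin (θ (s, t)) :=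
    fun s hs t ht => by rw [← (hpolar (s, t)).2.2, Function.comp_apply, hclamp_eq s hs t ht]
  refine not_continuous_angle_of_edge_signs hab hcd (fun t ht => ?_) (fun t ht => ?_)
    (fun s hs => ?_) (fun s hs => ?_) hθ
  · exact neg_of_mul_neg_right (hg_polar a (left_mem_Icc.2 hab) t ht ▸ ga t ht) (hpolar _).1.le
  · exact pos_of_mul_pos_right (hg_polar b (right_mem_Icc.2 hab) t ht ▸ gb t ht) (hpolar _).1.le
  · exact neg_of_mul_neg_right (hh_polar s hs c (left_mem_Icc.2 hcd) ▸ hc s hs) (hpolar _).1.le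
  · exact pos_of_mul_pos_right (hh_polar s hs d (right_mem_Icc.2 hcd) ▸ hd s hs) (hpolar _).1.le

variable {X : Type*} [TopologicalSpace X] {Z B D E : Set X}

/-- `D` splits off from `Z`: both `D` and its complement in `Z` are compact. For a compact set `Z`
in a Hausdorff space these are the relatively clopen subsets of `Z`. -/
structure IsClopenPart (Z D : Set X) : Prop where
  subset : D ⊆ Z
  isCompact : IsCompact D
  isCompact_sdiff : IsCompact (Z \ D)

lemma IsClopenPart.empty (hZ : IsCompact Z) : IsClopenPart Z ∅ :=
  ⟨empty_subset Z, isCompact_empty, by rwa [sdiff_empty]⟩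

lemma IsClopenPart.union [T2Space X] (hD : IsClopenPart Z D) (hE : IsClopenPart Z E) :
    IsClopenPart Z (D ∪ E) where
  subset := union_subset hD.subset hE.subset
  isCompact := hD.isCompact.union hE.isCompact
  isCompact_sdiff := by
    rw [← sdiff_inter_sdiff]
    exact hD.isCompact_sdiff.inter hE.isCompact_sdiff

/-- The points of `Z` that no relatively clopen subset of `Z` separates from `B`. For compact `Z`
and closed `B` these are the points whose component in `Z` meets `B`. -/
def linkedTo (Z B : Set X) : Set X :=
  {x ∈ Z | ∀ D, IsClopenPart Z D → x ∈ D → (D ∩ B).Nonempty}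

lemma linkedTo_mono {B' : Set X} (h : Z ∩ B ⊆ B') : linkedTo Z B ⊆ linkedTo Z B' :=
  fun _ hx => ⟨hx.1, fun D hD hxD =>
    (hx.2 D hD hxD).mono fun _ hz => ⟨hz.1, h ⟨hD.subset hz.1, hz.2⟩⟩⟩

lemma linkedTo_union_inter_subset (hB : IsCompact B) : linkedTo (Z ∪ B) B ∩ Z ⊆ linkedTo Z B := by
  refine fun x hx => ⟨hx.2, fun D hD hxD => not_disjoint_iff_nonempty_inter.1 fun hDB => ?_⟩
  have hsdiff : (Z ∪ B) \ D = (Z \ D) ∪ B := by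
    rw [union_sdiff_distrib, hDB.sdiff_eq_right]
  exact not_disjoint_iff_nonempty_inter.2 (hx.1.2 D ⟨hD.subset.trans subset_union_left,
    hD.isCompact, hsdiff ▸ hD.isCompact_sdiff.union hB⟩ hxD) hDB

lemma exists_isClopenPart_of_disjoint_linkedTo [T2Space X] (hZ : IsCompact Z) {A : Set X}
    (hA : IsCompact A) (hAZ : A ⊆ Z) (h : Disjoint A (linkedTo Z B)) :
    ∃ D, IsClopenPart Z D ∧ A ⊆ D ∧ Disjoint D B := by
  have hsep : ∀ x ∈ A, ∃ D, IsClopenPart Z D ∧ x ∈ D ∧ Disjoint D B := by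
    intro x hx
    by_contra! hcon
    exact disjoint_left.1 h hx
      ⟨hAZ hx, fun D hD hxD => not_disjoint_iff_nonempty_inter.1 (hcon D hD hxD)⟩
  suffices ∃ D, IsClopenPart Z D ∧ A ∩ Z ⊆ D ∧ Disjoint D B by rwa [inter_eq_left.2 hAZ] at this
  refine hA.induction_on (p := fun s => ∃ D, IsClopenPart Z D ∧ s ∩ Z ⊆ D ∧ Disjoint D B) ?_ ?_ ?_
    fun x hx => ?_
  · exact ⟨∅, .empty hZ, by simp, empty_disjoint B⟩
  · rintro s t hst ⟨D, hD, htD, hDB⟩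
    exact ⟨D, hD, (inter_subset_inter_left _ hst).trans htD, hDB⟩
  · rintro s t ⟨D, hD, hsD, hDB⟩ ⟨E, hE, htE, hEB⟩
    exact ⟨D ∪ E, hD.union hE, union_inter_distrib_right s t Z ▸ union_subset_union hsD htE,
      disjoint_union_left.2 ⟨hDB, hEB⟩⟩
  · obtain ⟨D, hD, hxD, hDB⟩ := hsep x hx
    refine ⟨(Z \ D)ᶜ, mem_nhdsWithin_of_mem_nhds
      (hD.isCompact_sdiff.isClosed.compl_mem_nhds fun hx' => hx'.2 hxD), D, hD, ?_, hDB⟩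
    exact fun y hy => of_not_not fun hyD => hy.1 ⟨hy.2, hyD⟩

lemma isClosed_linkedTo [T2Space X] (hZ : IsCompact Z) : IsClosed (linkedTo Z B) := by
  rw [← isOpen_compl_iff, isOpen_iff_mem_nhds]
  intro x hx
  by_cases hxZ : x ∈ Z
  · obtain ⟨D, hD, hxD, hDB⟩ := exists_isClopenPart_of_disjoint_linkedTo hZ isCompact_singleton
      (singleton_subset_iff.2 hxZ) (disjoint_singleton_left.2 hx)
    filter_upwards [hD.isCompact_sdiff.isClosed.compl_mem_nhds fun h => h.2 (hxD rfl)] with y hy hyL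
    exact not_disjoint_iff_nonempty_inter.2
      (hyL.2 D hD (of_not_not fun hyD => hy ⟨hyL.1, hyD⟩)) hDB
  · filter_upwards [hZ.isClosed.compl_mem_nhds hxZ] with y hy hyL using hy hyL.1

lemma connectedComponentIn_inter_nonempty_of_mem_linkedTo [T2Space X] (hZ : IsCompact Z)
    (hB : IsClosed B) {x : X} (hx : x ∈ linkedTo Z B) :
    (connectedComponentIn Z x ∩ B).Nonempty := by
  have : CompactSpace Z := isCompact_iff_compactSpace.1 hZ
  have hBc : IsCompact ((↑) ⁻¹' B : Set Z) := (hB.preimage continuous_subtype_val).isCompact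
  have hmeets : (((↑) ⁻¹' B : Set Z) ∩
      ⋂ s : {s : Set Z // IsClopen s ∧ (⟨x, hx.1⟩ : Z) ∈ s}, (s : Set Z)).Nonempty := by
    refine hBc.inter_iInter_nonempty _ (fun s => s.2.1.isClosed) fun u => ?_
    have hclopen : IsClopen (⋂ i ∈ u, (i : Set Z)) :=
      u.finite_toSet.isClopen_biInter fun i _ => i.2.1
    have hpart : IsClopenPart Z ((↑) '' (⋂ i ∈ u, (i : Set Z))) := by
      refine ⟨Subtype.coe_image_subset _ _,
        hclopen.isClosed.isCompact.image continuous_subtype_val, ?_⟩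
      convert hclopen.compl.isClosed.isCompact.image continuous_subtype_val using 1
      rw [image_compl_eq_range_sdiff_image Subtype.val_injective, Subtype.range_coe]
    obtain ⟨_, ⟨z, hz, rfl⟩, hzB⟩ := hx.2 _ hpart ⟨_, mem_iInter₂.2 fun i _ => i.2.2, rfl⟩
    exact ⟨z, hzB, hz⟩
  rw [← connectedComponent_eq_iInter_isClopen] at hmeets
  obtain ⟨z, hzB, hz⟩ := hmeets
  exact ⟨z, by rw [connectedComponentIn_eq_image hx.1]; exact ⟨z, hz, rfl⟩, hzB⟩

variable {g : ℝ × ℝ → ℝ} {a b c d : ℝ}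

/-- The zeros of `g` in a closed rectangle. -/
def rectZeros (g : ℝ × ℝ → ℝ) (a b c d : ℝ) : Set (ℝ × ℝ) :=
  {z | z ∈ Icc a b ×ˢ Icc c d ∧ g z = 0}

lemma isCompact_rectZeros (hg : ContinuousOn g (Icc a b ×ˢ Icc c d)) :
    IsCompact (rectZeros g a b c d) := by
  have hK : IsCompact (Icc a b ×ˢ Icc c d) := isCompact_Icc.prod isCompact_Icc
  exact hK.of_isClosed_subset (hg.preimage_isClosed_of_isClosed hK.isClosed isClosed_singleton)
    fun z hz => hz.1

/-- The zeros of `g` on the top edge of a rectangle that are joined to the bottom edge by a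
connected set of zeros; this is encoded by `linkedTo`, which passes to limits. -/
def linkedTop (g : ℝ × ℝ → ℝ) (a b c d : ℝ) : Set (ℝ × ℝ) :=
  {z ∈ linkedTo (rectZeros g a b c d) {z | z.2 ≤ c} | z.2 = d}

lemma isClosed_linkedTop (hg : ContinuousOn g (Icc a b ×ˢ Icc c d)) :
    IsClosed (linkedTop g a b c d) :=
  (isClosed_linkedTo (isCompact_rectZeros hg)).inter (isClosed_eq continuous_snd continuous_const)

lemma linkedTop_anti {c' : ℝ} (hcc : c' ≤ c) (hcd : c ≤ d)
    (hg : ContinuousOn g (Icc a b ×ˢ Icc c' d)) :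
    linkedTop g a b c' d ⊆ linkedTop g a b c d := by
  rintro x ⟨hx, hxd⟩
  have hlow : IsCompact (rectZeros g a b c' d ∩ {z | z.2 ≤ c}) :=
    (isCompact_rectZeros hg).inter_right (isClosed_le continuous_snd continuous_const)
  have hunion : rectZeros g a b c' d =
      rectZeros g a b c d ∪ (rectZeros g a b c' d ∩ {z | z.2 ≤ c}) := by
    ext z
    simp only [rectZeros, mem_union, mem_inter_iff, mem_prod, mem_Icc, mem_ofPred_eq]
    grind
  have hxc : x ∈ rectZeros g a b c d := ⟨⟨hx.1.1.1, hxd ▸ hcd, hxd.le⟩, hx.1.2⟩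
  have hx' := linkedTo_mono (fun z hz => ⟨hz.1, le_trans hz.2 hcc⟩ :
    rectZeros g a b c' d ∩ {z | z.2 ≤ c'} ⊆ rectZeros g a b c' d ∩ {z | z.2 ≤ c}) hx
  rw [hunion, ← hunion] at hx'
  exact ⟨linkedTo_mono (fun z hz => hz.2.2)
    (linkedTo_union_inter_subset hlow ⟨hunion ▸ hx', hxc⟩), hxd⟩

lemma linkedTop_nonempty (hab : a ≤ b) (hcd : c < d) (hg : ContinuousOn g (Icc a b ×ˢ Icc c d))
    (ga : ∀ t ∈ Icc c d, g (a, t) < 0) (gb : ∀ t ∈ Icc c d, 0 < g (b, t)) :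
    (linkedTop g a b c d).Nonempty := by
  by_contra hempty
  set Z := rectZeros g a b c d
  have hZ : IsCompact Z := isCompact_rectZeros hg
  obtain ⟨D, hD, htop, hbottom⟩ : ∃ D, IsClopenPart Z D ∧ Z ∩ {z | z.2 = d} ⊆ D ∧
      Disjoint D {z | z.2 ≤ c} :=
    exists_isClopenPart_of_disjoint_linkedTo hZ
      (hZ.inter_right (isClosed_eq continuous_snd continuous_const)) inter_subset_left
      (disjoint_left.2 fun x hx hxL => hempty ⟨x, hxL, hx.2⟩)
  have hedge : ∀ r : ℝ, IsClosed (Icc a b ×ˢ ({r} : Set ℝ)) := fun r =>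
    isClosed_Icc.prod isClosed_singleton
  have hdisj : Disjoint ((Z \ D) ∪ Icc a b ×ˢ ({c} : Set ℝ)) (D ∪ Icc a b ×ˢ ({d} : Set ℝ)) := by
    rw [Set.disjoint_left]
    rintro ⟨s, t⟩ (⟨hz, hzD⟩ | ⟨-, rfl : t = c⟩) (hzD' | ⟨-, ht : t = d⟩)
    · exact hzD hzD'
    · exact hzD (htop ⟨hz, ht⟩)
    · exact disjoint_left.1 hbottom hzD' (le_refl t)
    · exact hcd.ne ht
  obtain ⟨f, hf0, hf1, -⟩ := exists_continuous_zero_one_of_isClosed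
    (hD.isCompact_sdiff.isClosed.union (hedge c)) (hD.isCompact.isClosed.union (hedge d)) hdisj
  obtain ⟨z, hz, hgz, hfz⟩ := exists_common_zero_rectangle (h := fun z => f z - 1 / 2) hab hcd.le hg
    (by fun_prop) ga gb
    (fun s hs => by norm_num [hf0 (Or.inr ⟨hs, rfl⟩ : (s, c) ∈ _)])
    (fun s hs => by norm_num [hf1 (Or.inr ⟨hs, rfl⟩ : (s, d) ∈ _)])
  by_cases hzD : z ∈ D
  · norm_num [hf1 (Or.inl hzD : z ∈ _)] at hfz
  · norm_num [hf0 (Or.inl ⟨⟨hz, hgz⟩, hzD⟩ : z ∈ _)] at hfz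

/-- The components of a point of `⋂ linkedTop g a b (c n) d` in the zero sets over `[c n, d]`
increase with `n`, where `c n → 0`; their union is the required set. -/
theorem exists_connected_zeros_crossing (hab : a ≤ b) (hd : 0 < d)
    (hg : ContinuousOn g (Icc a b ×ˢ Ioc 0 d))
    (ga : ∀ t ∈ Ioc 0 d, g (a, t) < 0) (gb : ∀ t ∈ Ioc 0 d, 0 < g (b, t)) :
    ∃ C : Set (ℝ × ℝ), C ⊆ Icc a b ×ˢ Ioc 0 d ∧ (∀ z ∈ C, g z = 0) ∧ IsConnected C ∧
      ∀ t ∈ Ioc 0 d, ∃ z ∈ C, z.2 = t := by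
  obtain ⟨c, hc_anti, hc_mem, hc_lim⟩ := exists_seq_strictAnti_tendsto' hd
  have hlevel : ∀ n, Icc (c n) d ⊆ Ioc 0 d := fun n t ht => ⟨(hc_mem n).1.trans_le ht.1, ht.2⟩
  have hgn : ∀ n, ContinuousOn g (Icc a b ×ˢ Icc (c n) d) := fun n =>
    hg.mono (prod_mono_right (hlevel n))
  obtain ⟨x, hx⟩ : (⋂ n, linkedTop g a b (c n) d).Nonempty := by
    refine IsCompact.nonempty_iInter_of_sequence_nonempty_isCompact_isClosed _ (fun n => ?_)
      (fun n => ?_) ?_ (fun n => isClosed_linkedTop (hgn n))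
    · exact linkedTop_anti (hc_anti n.lt_succ_self).le (hc_mem n).2.le (hgn (n + 1))
    · exact linkedTop_nonempty hab (hc_mem n).2 (hgn n) (fun t ht => ga t (hlevel n ht))
        (fun t ht => gb t (hlevel n ht))
    · exact (isCompact_rectZeros (hgn 0)).of_isClosed_subset (isClosed_linkedTop (hgn 0))
        fun z hz => hz.1.1
  rw [mem_iInter] at hx
  let K : ℕ → Set (ℝ × ℝ) := fun n => connectedComponentIn (rectZeros g a b (c n) d) x
  have hxK : ∀ n, x ∈ K n := fun n => mem_connectedComponentIn (hx n).1.1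
  have hK : ∀ n, K n ⊆ rectZeros g a b (c n) d := fun n => connectedComponentIn_subset _ _
  refine ⟨⋃ n, K n, iUnion_subset fun n z hz => ⟨(hK n hz).1.1, hlevel n (hK n hz).1.2⟩, ?_,
    ⟨⟨x, mem_iUnion.2 ⟨0, hxK 0⟩⟩, isPreconnected_iUnion ⟨x, mem_iInter.2 hxK⟩
      fun n => isPreconnected_connectedComponentIn⟩, fun t ht => ?_⟩
  · intro z hz
    obtain ⟨n, hn⟩ := mem_iUnion.1 hz
    exact (hK n hn).2
  · obtain ⟨n, hn⟩ := (hc_lim.eventually (gt_mem_nhds ht.1)).exists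
    obtain ⟨z, hz, hzc⟩ := connectedComponentIn_inter_nonempty_of_mem_linkedTo
      (isCompact_rectZeros (hgn n)) (isClosed_le continuous_snd continuous_const) (hx n).1
    obtain ⟨w, hw, hwt⟩ := (isPreconnected_connectedComponentIn.image _
      continuous_snd.continuousOn).Icc_subset ⟨z, hz, rfl⟩ ⟨x, hxK n, rfl⟩
      (show t ∈ Icc z.2 x.2 from ⟨le_trans hzc hn.le, ht.2.trans_eq (hx n).2.symm⟩)
    exact ⟨w, mem_iUnion.2 ⟨n, hw⟩, hwt⟩

end Crossing

section SightLines

/-! ### Supporting lines and tangent directions -/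

lemma notMem_interior_of_support {E : Type*} [NormedAddCommGroup E] [InnerProductSpace ℝ E]
    {S : Set E} {m y : E} (hm : m ≠ 0) (h : ∀ y' ∈ S, ⟪y' - y, m⟫ ≤ 0) : y ∉ interior S := by
  intro hy
  have hmax : IsLocalMax (innerSL ℝ m) y := by
    filter_upwards [mem_interior_iff_mem_nhds.1 hy] with y' hy'
    simpa only [innerSL_apply_apply, inner_sub_right, sub_nonpos, real_inner_comm m] using h y' hy'
  have hzero := DFunLike.congr_fun (hmax.hasFDerivAt_eq_zero (innerSL ℝ m).hasFDerivAt) m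
  exact hm (by simpa using hzero)

lemma not_forall_inner_eq {E : Type*} [NormedAddCommGroup E] [InnerProductSpace ℝ E]
    {S : Set E} (hint : (interior S).Nonempty) {m : E} (hm : m ≠ 0) (r : ℝ) :
    ¬ ∀ y ∈ S, ⟪y, m⟫ = r := by
  intro h
  obtain ⟨y, hy⟩ := hint
  refine notMem_interior_of_support hm (fun y' hy' => ?_) hy
  rw [inner_sub_left, h y' hy', h y (interior_subset hy), sub_self]

lemma eq_inner_smul_add_inner_smul {e n : Plane} (he : ‖e‖ = 1) (hn : ‖n‖ = 1) (hen : ⟪e, n⟫ = 0)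
    (v : Plane) : v = ⟪v, e⟫ • e + ⟪v, n⟫ • n := by
  have hon : Orthonormal ℝ ![e, n] := by
    refine ⟨fun i => by fin_cases i <;> simp [he, hn], fun i j hij => ?_⟩
    fin_cases i <;> fin_cases j <;> simp_all [real_inner_comm]
  have hspan := (basisOfOrthonormalOfCardEqFinrank hon (by simp)).span_eq
  rw [coe_basisOfOrthonormalOfCardEqFinrank] at hspan
  simpa [Fin.sum_univ_two, real_inner_comm] using
    ((OrthonormalBasis.mk hon hspan.ge).sum_repr' v).symm

lemma mirror_neg_self (n : Plane) : mirror n (-n) = n := by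
  rw [mirror, Submodule.reflection_orthogonal_apply, map_neg, neg_neg]
  exact Submodule.reflection_mem_subspace_eq_self (Submodule.mem_span_singleton_self n)

lemma mirror_eq_self {m x : Plane} (h : ⟪m, x⟫ = 0) : mirror m x = x := by
  rw [mirror, Submodule.reflection_eq_self_iff]
  exact Submodule.mem_orthogonal_singleton_iff_inner_right.2 h

/-- The slope of the sight line from `c + t • n` to `y`: displacement in the direction `e` per unit
of depth in the direction `-n`. -/
def sightSlope (c e n : Plane) (t : ℝ) (y : Plane) : ℝ := ⟪y - c, e⟫ / (t - ⟪y - c, n⟫)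

/-- The largest slope under which a point of `S` is seen from `c + t • n`. The smallest slope is
`-upperSlope S c (-e) n t`. -/
def upperSlope (S : Set Plane) (c e n : Plane) (t : ℝ) : ℝ := sSup (image (sightSlope c e n t) S)

/-- The unit vector of slope `q` in the frame `e`, `-n`. -/
def slopeDir (e n : Plane) (q : ℝ) : Plane := (√(1 + q ^ 2))⁻¹ • (q • e - n)

lemma sightSlope_neg (c e n : Plane) (t : ℝ) (y : Plane) :
    sightSlope c (-e) n t y = -sightSlope c e n t y := by
  rw [sightSlope, sightSlope, inner_neg_right, neg_div]

lemma slopeDir_neg (e n : Plane) (q : ℝ) : slopeDir (-e) n (-q) = slopeDir e n q := by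
  simp only [slopeDir, neg_sq, smul_neg, neg_smul, neg_neg]

/-- `e`, `n` is an orthonormal frame at `c ∈ S` such that `n` is an outward normal of `S`. -/
structure ContactFrame (S : Set Plane) (c e n : Plane) : Prop where
  mem : c ∈ S
  norm_e : ‖e‖ = 1
  norm_n : ‖n‖ = 1
  orth : ⟪e, n⟫ = 0
  support : ∀ y ∈ S, ⟪y - c, n⟫ ≤ 0

namespace ContactFrame

variable {S : Set Plane} {c e n y : Plane} {t : ℝ}

lemma neg (h : ContactFrame S c e n) : ContactFrame S c (-e) n :=
  ⟨h.mem, by simpa using h.norm_e, h.norm_n, by simpa using h.orth, h.support⟩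

lemma n_ne_zero (h : ContactFrame S c e n) : n ≠ 0 :=
  ne_zero_of_norm_ne_zero (h.norm_n ▸ one_ne_zero)

lemma depth_pos (h : ContactFrame S c e n) (ht : 0 < t) (hy : y ∈ S) : 0 < t - ⟪y - c, n⟫ := by
  linarith [h.support y hy]

lemma continuousOn_sightSlope (h : ContactFrame S c e n) (ht : 0 < t) :
    ContinuousOn (sightSlope c e n t) S :=
  ContinuousOn.div (by fun_prop) (by fun_prop) fun _ hy => (h.depth_pos ht hy).ne'

lemma sightSlope_le (h : ContactFrame S c e n) (hS : IsCompact S) (ht : 0 < t) (hy : y ∈ S) :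
    sightSlope c e n t y ≤ upperSlope S c e n t :=
  le_csSup (hS.bddAbove_image (h.continuousOn_sightSlope ht)) (mem_image_of_mem _ hy)

lemma exists_sightSlope_eq (h : ContactFrame S c e n) (hS : IsCompact S) (ht : 0 < t) :
    ∃ y ∈ S, sightSlope c e n t y = upperSlope S c e n t := by
  obtain ⟨y, hy, hy'⟩ := hS.exists_sSup_image_eq ⟨c, h.mem⟩ (h.continuousOn_sightSlope ht)
  exact ⟨y, hy, hy'.symm⟩

lemma upperSlope_eq (h : ContactFrame S c e n) (hS : IsCompact S) (ht : 0 < t) (hy : y ∈ S)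
    (hmax : ∀ y' ∈ S, sightSlope c e n t y' ≤ sightSlope c e n t y) :
    upperSlope S c e n t = sightSlope c e n t y := by
  obtain ⟨y', hy', h'⟩ := h.exists_sightSlope_eq hS ht
  exact le_antisymm (h' ▸ hmax y' hy') (h.sightSlope_le hS ht hy)

lemma upperSlope_ne_neg (h : ContactFrame S c e n) (hS : IsCompact S)
    (hint : (interior S).Nonempty) (ht : 0 < t) :
    upperSlope S c e n t ≠ -upperSlope S c (-e) n t := by
  intro heq
  set q := upperSlope S c e n t
  have hline : e + q • n ≠ 0 := by
    intro h0
    simpa [inner_add_left, inner_smul_left, real_inner_comm e n, h.orth, h.norm_e] using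
      congrArg (fun v => ⟪v, e⟫) h0
  refine not_forall_inner_eq hint hline (⟪c, e + q • n⟫ + q * t) fun y hy => ?_
  have hlower := h.neg.sightSlope_le hS ht hy
  rw [sightSlope_neg] at hlower
  have hslope : sightSlope c e n t y = q := le_antisymm (h.sightSlope_le hS ht hy) (by linarith)
  rw [sightSlope, div_eq_iff (h.depth_pos ht hy).ne'] at hslope
  rw [← sub_eq_iff_eq_add', ← inner_sub_left, inner_add_right, inner_smul_right, hslope]
  ring

lemma inner_slopeDir_n (h : ContactFrame S c e n) (q : ℝ) :
    ⟪slopeDir e n q, n⟫ = -(√(1 + q ^ 2))⁻¹ := by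
  simp [slopeDir, inner_smul_left, inner_sub_left, h.orth, h.norm_n]

lemma inner_slopeDir_e (h : ContactFrame S c e n) (q : ℝ) :
    ⟪slopeDir e n q, e⟫ = (√(1 + q ^ 2))⁻¹ * q := by
  simp [slopeDir, inner_smul_left, inner_sub_left, real_inner_comm e n, h.orth, h.norm_e]

lemma norm_smul_add_smul (h : ContactFrame S c e n) (a b : ℝ) :
    ‖a • e + b • n‖ = √(a ^ 2 + b ^ 2) := by
  rw [← Real.sqrt_sq (norm_nonneg (a • e + b • n)), @norm_add_sq_real]
  simp [norm_smul, inner_smul_left, inner_smul_right, h.orth, h.norm_e, h.norm_n]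

lemma norm_slopeDir (h : ContactFrame S c e n) (q : ℝ) : ‖slopeDir e n q‖ = 1 := by
  have hs : 0 < √(1 + q ^ 2) := by positivity
  have hnorm := h.norm_smul_add_smul q (-1)
  rw [neg_one_smul, ← sub_eq_add_neg, neg_one_sq, add_comm] at hnorm
  rw [slopeDir, norm_smul, hnorm, norm_inv, Real.norm_of_nonneg hs.le, inv_mul_cancel₀ hs.ne']

lemma slopeDir_injective (h : ContactFrame S c e n) : Function.Injective (slopeDir e n) := by
  intro q r heq
  have hn := congrArg (fun v => ⟪v, n⟫) heq
  have he := congrArg (fun v => ⟪v, e⟫) heq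
  simp only [h.inner_slopeDir_n, h.inner_slopeDir_e, neg_inj] at hn he
  rw [hn] at he
  exact mul_left_cancel₀ (by positivity) he

lemma sub_eq_smul (h : ContactFrame S c e n) (ht : 0 < t) (hy : y ∈ S) :
    y - (c + t • n) = (t - ⟪y - c, n⟫) • (sightSlope c e n t y • e - n) := by
  rw [smul_sub, smul_smul, sightSlope, mul_div_cancel₀ _ (h.depth_pos ht hy).ne']
  conv_lhs => rw [← sub_sub, eq_inner_smul_add_inner_smul h.norm_e h.norm_n h.orth (y - c)]
  module

lemma sub_eq_smul_slopeDir (h : ContactFrame S c e n) (ht : 0 < t) (hy : y ∈ S) :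
    y - (c + t • n) = ((t - ⟪y - c, n⟫) * √(1 + sightSlope c e n t y ^ 2)) •
      slopeDir e n (sightSlope c e n t y) := by
  rw [slopeDir, smul_smul, mul_inv_cancel_right₀ (by positivity)]
  exact h.sub_eq_smul ht hy

lemma inner_sub_eq (h : ContactFrame S c e n) (ht : 0 < t) (hy : y ∈ S) (m : Plane) :
    ⟪y - (c + t • n), m⟫ = (t - ⟪y - c, n⟫) * (⟪m, e⟫ * sightSlope c e n t y - ⟪m, n⟫) := by
  rw [h.sub_eq_smul ht hy, real_inner_smul_left, inner_sub_left (𝕜 := ℝ) (_ • e) n,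
    real_inner_smul_left, real_inner_comm m e, real_inner_comm m n, mul_comm (sightSlope ..)]

lemma isTangentDirection_slopeDir (h : ContactFrame S c e n) (hS : IsCompact S) (ht : 0 < t) :
    IsTangentDirection S (c + t • n) (slopeDir e n (upperSlope S c e n t)) := by
  obtain ⟨y, hy, hyq⟩ := h.exists_sightSlope_eq hS ht
  set q := upperSlope S c e n t
  have hs : 0 < √(1 + q ^ 2) := by positivity
  refine ⟨h.norm_slopeDir q, ⟨(t - ⟪y - c, n⟫) * √(1 + q ^ 2),
    mul_nonneg (h.depth_pos ht hy).le hs.le, ?_⟩,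
    (√(1 + q ^ 2))⁻¹ • ((1 : ℝ) • e + q • n), ?_, ?_, fun y' hy' => ?_⟩
  · rw [← hyq, ← h.sub_eq_smul_slopeDir ht hy, add_sub_cancel]
    exact hy
  · rw [norm_smul, h.norm_smul_add_smul, norm_inv, Real.norm_of_nonneg hs.le, one_pow,
      inv_mul_cancel₀ hs.ne']
  · rw [inner_smul_right, inner_add_right, inner_smul_right, inner_smul_right,
      h.inner_slopeDir_n, h.inner_slopeDir_e]
    ring
  · have hm : ⟪(1 : ℝ) • e + q • n, e⟫ = 1 ∧ ⟪(1 : ℝ) • e + q • n, n⟫ = q := by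
      simp [inner_add_left, inner_smul_left, real_inner_comm e n, h.orth, h.norm_e, h.norm_n]
    rw [inner_smul_right, h.inner_sub_eq ht hy', hm.1, hm.2, one_mul]
    exact mul_nonpos_of_nonneg_of_nonpos (inv_nonneg.2 hs.le) (mul_nonpos_of_nonneg_of_nonpos
      (h.depth_pos ht hy').le (sub_nonpos.2 (h.sightSlope_le hS ht hy')))

lemma eq_slopeDir_sightSlope (h : ContactFrame S c e n) (ht : 0 < t) {d : Plane} (hd : ‖d‖ = 1)
    {τ : ℝ} (hτ : 0 ≤ τ) (hy : c + t • n + τ • d ∈ S) :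
    d = slopeDir e n (sightSlope c e n t (c + t • n + τ • d)) := by
  have hray := h.sub_eq_smul_slopeDir ht hy
  rw [add_sub_cancel_left] at hray
  set q := sightSlope c e n t (c + t • n + τ • d)
  have hr : 0 < (t - ⟪c + t • n + τ • d - c, n⟫) * √(1 + q ^ 2) :=
    mul_pos (h.depth_pos ht hy) (by positivity)
  have hτr := congrArg norm hray
  rw [norm_smul, norm_smul, hd, h.norm_slopeDir, mul_one, mul_one, Real.norm_of_nonneg hτ,
    Real.norm_of_nonneg hr.le] at hτr
  rw [← hτr] at hray hr
  exact smul_right_injective _ hr.ne' hray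

lemma upperSlope_eq_of_support (h : ContactFrame S c e n) (hS : IsCompact S) (ht : 0 < t)
    (hy : y ∈ S) {m : Plane} (hm : 0 < ⟪m, e⟫) (hym : ⟪y - (c + t • n), m⟫ = 0)
    (hsup : ∀ y' ∈ S, ⟪y' - (c + t • n), m⟫ ≤ 0) :
    upperSlope S c e n t = sightSlope c e n t y := by
  refine h.upperSlope_eq hS ht hy fun y' hy' => le_of_mul_le_mul_left ?_ hm
  have hle := hsup y' hy'
  rw [h.inner_sub_eq ht hy'] at hle
  have hle' := nonpos_of_mul_nonpos_right hle (h.depth_pos ht hy')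
  rw [h.inner_sub_eq ht hy, mul_eq_zero_iff_left (h.depth_pos ht hy).ne'] at hym
  linarith

lemma eq_slopeDir_of_isTangentDirection (h : ContactFrame S c e n) (hS : IsCompact S) (ht : 0 < t)
    {d : Plane} (hd : IsTangentDirection S (c + t • n) d) :
    d = slopeDir e n (upperSlope S c e n t) ∨
      d = slopeDir (-e) n (upperSlope S c (-e) n t) := by
  obtain ⟨hd1, ⟨τ, hτ, hy⟩, m, hm, hdm, hsup⟩ := hd
  have hym : ⟪c + t • n + τ • d - (c + t • n), m⟫ = 0 := by
    rw [add_sub_cancel_left, inner_smul_left, hdm, mul_zero]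
  have hme : ⟪m, e⟫ ≠ 0 := by
    intro h0
    have hmn := h.inner_sub_eq ht hy m
    rw [hym, h0, zero_mul, zero_sub, eq_comm, mul_eq_zero_iff_left (h.depth_pos ht hy).ne',
      neg_eq_zero] at hmn
    have hm0 := eq_inner_smul_add_inner_smul h.norm_e h.norm_n h.orth m
    rw [h0, hmn, zero_smul, zero_smul, add_zero] at hm0
    simp [hm0] at hm
  rcases hme.lt_or_gt with hneg | hpos
  · right
    rw [h.neg.upperSlope_eq_of_support hS ht hy (by simpa using hneg) hym hsup]
    exact h.neg.eq_slopeDir_sightSlope ht hd1 hτ hy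
  · left
    rw [h.upperSlope_eq_of_support hS ht hy hpos hym hsup]
    exact h.eq_slopeDir_sightSlope ht hd1 hτ hy

lemma tangentDirections_spec (h : ContactFrame S c e n) (hS : IsCompact S)
    (hint : (interior S).Nonempty) (ht : 0 < t) :
    IsTangentDirection S (c + t • n) (tangentDirections S (c + t • n)).1 ∧
      IsTangentDirection S (c + t • n) (tangentDirections S (c + t • n)).2 := by
  refine (Classical.epsilon_spec (p := fun d : Plane × Plane => d.1 ≠ d.2 ∧
    IsTangentDirection S (c + t • n) d.1 ∧ IsTangentDirection S (c + t • n) d.2)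
    ⟨(slopeDir e n (upperSlope S c e n t), slopeDir (-e) n (upperSlope S c (-e) n t)), ?_,
      h.isTangentDirection_slopeDir hS ht, h.neg.isTangentDirection_slopeDir hS ht⟩).2
  rw [← slopeDir_neg (-e), neg_neg]
  exact h.slopeDir_injective.ne (h.upperSlope_ne_neg hS hint ht)

lemma hitTime_eq (h : ContactFrame S c e n) (ht : 0 < t) : hitTime S (c + t • n, -n) = t := by
  refine IsLeast.csInf_eq ⟨⟨ht.le, by simpa using h.mem⟩, ?_⟩
  rintro τ ⟨-, hmem⟩
  have hsup := h.support _ hmem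
  rw [show c + t • n + τ • -n - c = (t - τ) • n by module, inner_smul_left,
    real_inner_self_eq_norm_sq, h.norm_n] at hsup
  simpa using hsup

lemma infDist_eq (h : ContactFrame S c e n) (ht : 0 < t) : infDist (c + t • n) S = t := by
  refine le_antisymm ((infDist_le_dist_of_mem h.mem).trans_eq ?_)
    ((le_infDist ⟨c, h.mem⟩).2 fun y hy => ?_)
  · rw [dist_eq_norm, add_sub_cancel_left, norm_smul, h.norm_n, mul_one, Real.norm_of_nonneg ht.le]
  · calc t ≤ t - ⟪y - c, n⟫ := by linarith [h.support y hy]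
      _ = ⟪c + t • n - y, n⟫ := by
        simp only [inner_sub_left, inner_add_left, inner_smul_left, real_inner_self_eq_norm_sq,
          h.norm_n, conj_trivial]
        ring
      _ ≤ dist (c + t • n) y := by
        simpa [h.norm_n, dist_eq_norm] using real_inner_le_norm (c + t • n - y) n

lemma bisectorReflection_neg (h : ContactFrame S c e n) (hS : IsCompact S)
    (hint : (interior S).Nonempty) (ht : 0 < t)
    (heq : upperSlope S c e n t = upperSlope S c (-e) n t) :
    bisectorReflection S (c + t • n) (-n) = -n := by
  have hinner : ∀ d, IsTangentDirection S (c + t • n) d →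
      ⟪d, n⟫ = -(√(1 + upperSlope S c e n t ^ 2))⁻¹ := by
    intro d hd
    rcases h.eq_slopeDir_of_isTangentDirection hS ht hd with rfl | rfl
    · exact h.inner_slopeDir_n _
    · rw [h.neg.inner_slopeDir_n, heq]
  obtain ⟨hfst, hsnd⟩ := h.tangentDirections_spec hS hint ht
  refine mirror_eq_self ?_
  rw [inner_neg_right, inner_sub_left, hinner _ hfst, hinner _ hsnd, sub_self, neg_zero]

theorem mem_exteriorFixedPoints (h : ContactFrame S c e n) (hS : IsCompact S)
    (hint : (interior S).Nonempty) (huniq : ∀ m, IsOuterNormal S c m → m = n) (ht : 0 < t)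
    (heq : upperSlope S c e n t = upperSlope S c (-e) n t) :
    (c + t • n, -n) ∈ exteriorFixedPoints S := by
  have hout : c + t • n ∉ S := fun hmem =>
    ht.ne ((infDist_zero_of_mem hmem).symm.trans (h.infDist_eq ht))
  have hbounce : bouncePoint S (c + t • n, -n) = c := by
    simp [bouncePoint, h.hitTime_eq ht]
  have hnormal : outerNormal S c = n :=
    huniq _ (Classical.epsilon_spec ⟨n, h.norm_n, h.support⟩)
  have hdir : bouncedDirection S (c + t • n, -n) = n := by
    rw [bouncedDirection, hbounce, hnormal, mirror_neg_self]
  have hnew : newPoint S (c + t • n, -n) = c + t • n := by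
    rw [newPoint, hbounce, h.hitTime_eq ht, hdir]
  refine ⟨⟨fun hi => hout (interior_subset hi), by simpa using h.norm_n, t, ht.le, ?_⟩, hout, ?_⟩
  · simpa using h.mem
  · rw [bouncingOuterBilliard, hnew, hdir, h.bisectorReflection_neg hS hint ht heq]

end ContactFrame

end SightLines

/-! ### The moving frame of the boundary -/

/-- Rotation of the plane by a right angle; it turns the tangent of a curve into a normal. -/
def quarterTurn : Plane →L[ℝ] Plane :=
  LinearMap.toContinuousLinearMap
    { toFun := fun v => !₂[-v 1, v 0]
      map_add' := fun v w => by ext i; fin_cases i <;> simp [add_comm]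
      map_smul' := fun r v => by ext i; fin_cases i <;> simp }

lemma quarterTurn_apply (v : Plane) : quarterTurn v = !₂[-v 1, v 0] := rfl

lemma norm_quarterTurn (v : Plane) : ‖quarterTurn v‖ = ‖v‖ := by
  simp [quarterTurn_apply, EuclideanSpace.norm_eq, Fin.sum_univ_two, add_comm]

lemma inner_quarterTurn_self (v : Plane) : ⟪v, quarterTurn v⟫ = 0 := by
  simp [quarterTurn_apply, PiLp.inner_apply, Fin.sum_univ_two]
  ring

lemma quarterTurn_quarterTurn (v : Plane) : quarterTurn (quarterTurn v) = -v := by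
  ext i; fin_cases i <;> simp [quarterTurn_apply]

lemma exists_isOuterNormal {S : Set Plane} (hconv : Convex ℝ S)
    (hint : (interior S).Nonempty) {x : Plane} (hx : x ∈ frontier S) :
    ∃ ν, IsOuterNormal S x ν := by
  obtain ⟨f, hf⟩ := geometric_hahn_banach_open_point hconv.interior isOpen_interior hx.2
  set m := (InnerProductSpace.toDual ℝ Plane).symm f with hm
  have hfm : ∀ y, f y = ⟪y, m⟫ := fun y => by
    rw [real_inner_comm, hm, InnerProductSpace.toDual_symm_apply]
  simp only [hfm] at hf
  have hle : ∀ y ∈ S, ⟪y - x, m⟫ ≤ 0 := by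
    have hclosure : closure (interior S) ⊆ {y | ⟪y - x, m⟫ ≤ 0} :=
      closure_minimal (fun y hy => by simpa [inner_sub_left] using (hf y hy).le)
        (isClosed_le (by fun_prop) continuous_const)
    rw [hconv.closure_interior_eq_closure_of_nonempty_interior hint] at hclosure
    exact fun y hy => hclosure (subset_closure hy)
  have hm0 : m ≠ 0 := by
    intro h0
    obtain ⟨y, hy⟩ := hint
    simpa [h0] using hf y hy
  refine ⟨‖m‖⁻¹ • m, norm_smul_inv_norm hm0, fun y hy => ?_⟩
  rw [inner_smul_right]
  exact mul_nonpos_of_nonneg_of_nonpos (by positivity) (hle y hy)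

lemma IsOuterNormal.not_neg {S : Set Plane} (hint : (interior S).Nonempty) {x m : Plane}
    (hm : IsOuterNormal S x m) : ¬ IsOuterNormal S x (-m) := by
  intro hneg
  have hm0 : m ≠ 0 := ne_zero_of_norm_ne_zero (hm.1 ▸ one_ne_zero)
  refine not_forall_inner_eq hint hm0 ⟪x, m⟫ fun y hy => ?_
  have hupper := hm.2 y hy
  have hlower := hneg.2 y hy
  rw [inner_neg_right] at hlower
  rw [inner_sub_left] at hupper hlower
  linarith

lemma IsOuterNormal.eq_or_eq_neg {S : Set Plane} {γ : ℝ → Plane} {s : ℝ} {T n m : Plane}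
    (hγS : ∀ u, γ u ∈ S) (hγ : HasDerivAt γ T s) (hT : ‖T‖ = 1) (hn : ‖n‖ = 1) (hTn : ⟪T, n⟫ = 0)
    (hm : IsOuterNormal S (γ s) m) : m = n ∨ m = -n := by
  have hderiv : HasDerivAt (fun u => ⟪γ u - γ s, m⟫) ⟪T, m⟫ s := by
    simpa using (hγ.sub_const (γ s)).inner ℝ (hasDerivAt_const s m)
  have hmax : IsLocalMax (fun u => ⟪γ u - γ s, m⟫) s :=
    Eventually.of_forall fun u => by simpa using hm.2 _ (hγS u)
  have hexp := eq_inner_smul_add_inner_smul hT hn hTn m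
  rw [real_inner_comm, hmax.hasDerivAt_eq_zero hderiv, zero_smul, zero_add] at hexp
  have habs : |⟪m, n⟫| = 1 := by
    have hnorm := congrArg norm hexp
    rwa [hm.1, norm_smul, hn, mul_one, Real.norm_eq_abs, eq_comm] at hnorm
  refine (eq_or_eq_neg_of_abs_eq habs).imp (fun h => ?_) fun h => ?_
  · rwa [h, one_smul] at hexp
  · rwa [h, neg_one_smul] at hexp

lemma isClosed_setOf_isOuterNormal {X : Type*} [TopologicalSpace X] (S : Set Plane)
    {x m : X → Plane} (hx : Continuous x) (hm : Continuous m) :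
    IsClosed {s | IsOuterNormal S (x s) (m s)} := by
  simp only [IsOuterNormal, ofPred_and, ofPred_forall]
  exact (isClosed_eq (by fun_prop) continuous_const).inter <| isClosed_iInter fun y =>
    isClosed_iInter fun _ => isClosed_le (by fun_prop) continuous_const

/-- The boundary of the convex body `S`, parametrized by arc length, with tangent `T`, outward
normal `ν` and curvature `κ`, subject to the Frenet equations. The orientation is the one for which
`T` turns towards `-ν`, so that `κ` is nonnegative. -/
structure BoundaryFrame (S : Set Plane) (L : ℝ) (γ T ν : ℝ → Plane) (κ : ℝ → ℝ) : Prop where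
  convex : Convex ℝ S
  compact : IsCompact S
  int : (interior S).Nonempty
  L_pos : 0 < L
  deriv_curve : ∀ s, HasDerivAt γ (T s) s
  deriv_tangent : ∀ s, HasDerivAt T (-κ s • ν s) s
  deriv_normal : ∀ s, HasDerivAt ν (κ s • T s) s
  contDiff_curv : ContDiff ℝ 1 κ
  periodic : Function.Periodic γ L
  periodic_normal : Function.Periodic ν L
  periodic_curv : Function.Periodic κ L
  curve_ne : ∀ a b, a < b → b < a + L → γ a ≠ γ b
  range_eq : range γ = frontier S
  norm_tangent : ∀ s, ‖T s‖ = 1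
  norm_normal : ∀ s, ‖ν s‖ = 1
  orth : ∀ s, ⟪T s, ν s⟫ = 0
  support : ∀ s, ∀ y ∈ S, ⟪y - γ s, ν s⟫ ≤ 0

namespace BoundaryFrame

variable {S : Set Plane} {L : ℝ} {γ T ν : ℝ → Plane} {κ : ℝ → ℝ}

lemma reverse (F : BoundaryFrame S L γ T ν κ) :
    BoundaryFrame S L (fun s => γ (-s)) (fun s => -T (-s)) (fun s => ν (-s)) (fun s => κ (-s)) where
  convex := F.convex
  compact := F.compact
  int := F.int
  L_pos := F.L_pos
  deriv_curve s := by
    rw [← neg_one_smul ℝ (T (-s))]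
    exact (F.deriv_curve (-s)).scomp s (hasDerivAt_neg s)
  deriv_tangent s := by
    rw [← neg_neg (-κ (-s) • ν (-s)), ← neg_one_smul ℝ (-κ (-s) • ν (-s))]
    exact ((F.deriv_tangent (-s)).scomp s (hasDerivAt_neg s)).neg
  deriv_normal s := by
    rw [smul_neg, ← neg_one_smul ℝ]
    exact (F.deriv_normal (-s)).scomp s (hasDerivAt_neg s)
  contDiff_curv := F.contDiff_curv.comp contDiff_neg
  periodic s := (congrArg _ (neg_add' s L)).trans (F.periodic.sub_eq (-s))
  periodic_normal s := (congrArg _ (neg_add' s L)).trans (F.periodic_normal.sub_eq (-s))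
  periodic_curv s := (congrArg _ (neg_add' s L)).trans (F.periodic_curv.sub_eq (-s))
  curve_ne a b hab hba := (F.curve_ne (-b) (-a) (by linarith) (by linarith)).symm
  range_eq := by
    rw [← F.range_eq]
    exact (Equiv.neg ℝ).surjective.range_comp γ
  norm_tangent s := by simpa using F.norm_tangent (-s)
  norm_normal s := F.norm_normal (-s)
  orth s := by simpa using F.orth (-s)
  support s := F.support (-s)

lemma continuous_curve (F : BoundaryFrame S L γ T ν κ) : Continuous γ :=
  continuous_iff_continuousAt.2 fun s => (F.deriv_curve s).continuousAt

lemma continuous_tangent (F : BoundaryFrame S L γ T ν κ) : Continuous T :=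
  continuous_iff_continuousAt.2 fun s => (F.deriv_tangent s).continuousAt

lemma continuous_normal (F : BoundaryFrame S L γ T ν κ) : Continuous ν :=
  continuous_iff_continuousAt.2 fun s => (F.deriv_normal s).continuousAt

lemma continuous_curv (F : BoundaryFrame S L γ T ν κ) : Continuous κ := F.contDiff_curv.continuous

lemma curve_mem_frontier (F : BoundaryFrame S L γ T ν κ) (s : ℝ) : γ s ∈ frontier S :=
  F.range_eq ▸ mem_range_self s

lemma curve_mem (F : BoundaryFrame S L γ T ν κ) (s : ℝ) : γ s ∈ S :=
  F.compact.isClosed.frontier_subset (F.curve_mem_frontier s)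

lemma contactFrame (F : BoundaryFrame S L γ T ν κ) (s : ℝ) : ContactFrame S (γ s) (T s) (ν s) :=
  ⟨F.curve_mem s, F.norm_tangent s, F.norm_normal s, F.orth s, F.support s⟩

lemma hasDerivAt_inner_curve (F : BoundaryFrame S L γ T ν κ) (c m : Plane) (s : ℝ) :
    HasDerivAt (fun u => ⟪γ u - c, m⟫) ⟪T s, m⟫ s := by
  simpa using ((F.deriv_curve s).sub_const c).inner ℝ (hasDerivAt_const s m)

lemma hasDerivAt_inner_tangent (F : BoundaryFrame S L γ T ν κ) (m : Plane) (s : ℝ) :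
    HasDerivAt (fun u => ⟪T u, m⟫) (-κ s * ⟪ν s, m⟫) s := by
  simpa [inner_smul_left] using (F.deriv_tangent s).inner ℝ (hasDerivAt_const s m)

lemma hasDerivAt_inner_normal (F : BoundaryFrame S L γ T ν κ) (m : Plane) (s : ℝ) :
    HasDerivAt (fun u => ⟪ν u, m⟫) (κ s * ⟪T s, m⟫) s := by
  simpa [inner_smul_left] using (F.deriv_normal s).inner ℝ (hasDerivAt_const s m)

lemma isOuterNormal (F : BoundaryFrame S L γ T ν κ) (s : ℝ) : IsOuterNormal S (γ s) (ν s) :=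
  ⟨F.norm_normal s, F.support s⟩

lemma eq_normal (F : BoundaryFrame S L γ T ν κ) {s : ℝ} {m : Plane}
    (hm : IsOuterNormal S (γ s) m) : m = ν s := by
  refine (hm.eq_or_eq_neg F.curve_mem (F.deriv_curve s) (F.norm_tangent s) (F.norm_normal s)
    (F.orth s)).resolve_right ?_
  rintro rfl
  exact (F.isOuterNormal s).not_neg F.int hm

lemma curv_nonneg (F : BoundaryFrame S L γ T ν κ) (s : ℝ) : 0 ≤ κ s := by
  by_contra! hneg
  set f : ℝ → ℝ := fun u => ⟪γ u - γ s, ν s⟫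
  have hfs : f s = 0 := by simp [f]
  have hderiv : deriv f = fun u => ⟪T u, ν s⟫ :=
    funext fun u => (F.hasDerivAt_inner_curve _ _ u).deriv
  have hderiv2 : deriv (deriv f) s = -κ s := by
    rw [hderiv, (F.hasDerivAt_inner_tangent _ s).deriv, real_inner_self_eq_norm_sq,
      F.norm_normal, one_pow, mul_one]
  have hmin : IsLocalMin f s :=
    isLocalMin_of_deriv_deriv_pos (hderiv2 ▸ neg_pos.2 hneg) (by rw [hderiv]; exact F.orth s)
      (F.hasDerivAt_inner_curve _ _ s).continuousAt
  have hconst : f =ᶠ[𝓝 s] fun _ => 0 := by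
    filter_upwards [hmin] with u hu
    exact le_antisymm (F.support s _ (F.curve_mem u)) (hfs ▸ hu)
  have hzero := hconst.deriv.deriv_eq
  simp only [hderiv2, deriv_const', neg_eq_zero] at hzero
  exact hneg.ne hzero

lemma curvature_eq (F : BoundaryFrame S L γ T ν κ) : curvature γ = κ := by
  ext s
  have hT : deriv γ = T := funext fun u => (F.deriv_curve u).deriv
  rw [curvature, hT, (F.deriv_tangent s).deriv, norm_smul, F.norm_normal, norm_neg,
    Real.norm_of_nonneg (F.curv_nonneg s), mul_one]

end BoundaryFrame

section ExistsBoundaryFrame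

variable {S : Set Plane} {L : ℝ} {γ : ℝ → Plane}

lemma ne_of_periodic_of_injOn {α : Type*} {f : ℝ → α} (hL : 0 < L) (hf : Function.Periodic f L)
    (hinj : InjOn f (Ico 0 L)) {a b : ℝ} (hab : a < b) (hba : b < a + L) : f a ≠ f b := by
  intro heq
  have hmod : ∀ x, f (toIcoMod hL 0 x) = f x := fun x => hf.sub_zsmul_eq _
  have hmem : ∀ x, toIcoMod hL 0 x ∈ Ico 0 L := fun x => by simpa using toIcoMod_mem_Ico hL 0 x
  obtain ⟨k, hk⟩ := (toIcoMod_eq_toIcoMod hL).1 <|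
    hinj (hmem a) (hmem b) (by rw [hmod, hmod, heq])
  rw [zsmul_eq_mul] at hk
  have hpos : (0 : ℝ) < k := pos_of_mul_pos_left (by linarith) hL.le
  have hlt : (k : ℝ) < 1 := lt_of_mul_lt_mul_right (by linarith) hL.le
  norm_cast at hpos hlt
  lia

lemma periodic_deriv {E : Type*} [NormedAddCommGroup E] [NormedSpace ℝ E] {f : ℝ → E}
    (hf : Function.Periodic f L) : Function.Periodic (deriv f) L := fun s => by
  rw [← deriv_comp_add_const, funext hf]

lemma inner_deriv_eq_zero_of_norm_eq {E : Type*} [NormedAddCommGroup E] [InnerProductSpace ℝ E]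
    {f : ℝ → E} {f' : E} {s r : ℝ} (hf : HasDerivAt f f' s) (hr : ∀ u, ‖f u‖ = r) :
    ⟪f', f s⟫ = 0 := by
  have hconst : HasDerivAt (fun u => ‖f u‖ ^ 2) 0 s := by
    simpa only [hr] using hasDerivAt_const s (r ^ 2)
  rw [real_inner_comm]
  simpa using hf.norm_sq.unique hconst

namespace IsArcLengthBoundary

lemma hasDerivAt (hγ : IsArcLengthBoundary S L γ) (s : ℝ) : HasDerivAt γ (deriv γ s) s :=
  (hγ.contDiff.differentiable (by norm_num) s).hasDerivAt

lemma contDiff_deriv (hγ : IsArcLengthBoundary S L γ) : ContDiff ℝ 2 (deriv γ) :=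
  (contDiff_succ_iff_deriv.1 (show ContDiff ℝ (2 + 1) γ from hγ.contDiff)).2.2

lemma contDiff_deriv_deriv (hγ : IsArcLengthBoundary S L γ) : ContDiff ℝ 1 (deriv (deriv γ)) :=
  (contDiff_succ_iff_deriv.1 (show ContDiff ℝ (1 + 1) (deriv γ) from hγ.contDiff_deriv)).2.2

lemma boundaryFrame (hγ : IsArcLengthBoundary S L γ) (hconv : Convex ℝ S) (hcomp : IsCompact S)
    (hint : (interior S).Nonempty) {J : Plane →L[ℝ] Plane} (hJ : ∀ v, ⟪v, J v⟫ = 0)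
    (hJJ : ∀ v, J (J v) = -v) (hν : ∀ s, IsOuterNormal S (γ s) (J (deriv γ s))) :
    BoundaryFrame S L γ (deriv γ) (fun s => J (deriv γ s))
      (fun s => -⟪deriv (deriv γ) s, J (deriv γ s)⟫) := by
  have hT : ∀ s, HasDerivAt (deriv γ) (deriv (deriv γ) s) s := fun s =>
    (hγ.contDiff_deriv.differentiable two_ne_zero s).hasDerivAt
  have hderivT : ∀ s, deriv (deriv γ) s =
      -(-⟪deriv (deriv γ) s, J (deriv γ s)⟫) • J (deriv γ s) := fun s => by
    rw [neg_neg]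
    simpa [inner_deriv_eq_zero_of_norm_eq (hT s) hγ.unit_speed] using
      eq_inner_smul_add_inner_smul (hγ.unit_speed s) (hν s).1 (hJ _) (deriv (deriv γ) s)
  have hTper : Function.Periodic (deriv γ) L := periodic_deriv hγ.periodic
  exact {
    convex := hconv
    compact := hcomp
    int := hint
    L_pos := hγ.length_pos
    deriv_curve := hγ.hasDerivAt
    deriv_tangent := fun s => hderivT s ▸ hT s
    deriv_normal := fun s => by
      have hJT := J.hasFDerivAt.comp_hasDerivAt s (hT s)
      rw [hderivT s, map_smul, hJJ, smul_neg, neg_smul, neg_neg] at hJT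
      exact hJT
    contDiff_curv := (hγ.contDiff_deriv_deriv.inner ℝ
      (J.contDiff.comp (hγ.contDiff_deriv.of_le one_le_two))).neg
    periodic := hγ.periodic
    periodic_normal := hTper.comp J
    periodic_curv := fun s => by simp only [hTper s, periodic_deriv hTper s]
    curve_ne := fun a b => ne_of_periodic_of_injOn hγ.length_pos hγ.periodic hγ.injOn
    range_eq := hγ.range_eq
    norm_tangent := hγ.unit_speed
    norm_normal := fun s => (hν s).1
    orth := fun s => hJ _
    support := fun s => (hν s).2 }

lemma isOuterNormal_quarterTurn_or_neg (hγ : IsArcLengthBoundary S L γ) (hconv : Convex ℝ S)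
    (hcomp : IsCompact S) (hint : (interior S).Nonempty) :
    (∀ s, IsOuterNormal S (γ s) (quarterTurn (deriv γ s))) ∨
      ∀ s, IsOuterNormal S (γ s) (-quarterTurn (deriv γ s)) := by
  set n : ℝ → Plane := fun s => quarterTurn (deriv γ s)
  have hn : Continuous n :=
    quarterTurn.continuous.comp (hγ.contDiff.continuous_deriv (by norm_num))
  have hfrontier : ∀ s, γ s ∈ frontier S := fun s => hγ.range_eq ▸ mem_range_self s
  have hcover : ∀ s, IsOuterNormal S (γ s) (n s) ∨ IsOuterNormal S (γ s) (-n s) := fun s => by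
    obtain ⟨m, hm⟩ := exists_isOuterNormal hconv hint (hfrontier s)
    have hsign : m = n s ∨ m = -n s :=
      hm.eq_or_eq_neg (fun u => hcomp.isClosed.frontier_subset (hfrontier u)) (hγ.hasDerivAt s)
        (hγ.unit_speed s) ((norm_quarterTurn _).trans (hγ.unit_speed s))
        (inner_quarterTurn_self _)
    rcases hsign with rfl | rfl
    exacts [Or.inl hm, Or.inr hm]
  have hcompl : {s | IsOuterNormal S (γ s) (n s)} = {s | IsOuterNormal S (γ s) (-n s)}ᶜ :=
    Set.ext fun s => ⟨fun hs => hs.not_neg hint, (hcover s).resolve_right⟩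
  have hclopen : IsClopen {s | IsOuterNormal S (γ s) (n s)} :=
    ⟨isClosed_setOf_isOuterNormal S hγ.contDiff.continuous hn, by
      rw [hcompl]
      exact (isClosed_setOf_isOuterNormal S hγ.contDiff.continuous hn.neg).isOpen_compl⟩
  rcases isClopen_iff.1 hclopen with hempty | huniv
  · exact Or.inr fun s => (hcover s).resolve_left (eq_empty_iff_forall_notMem.1 hempty s)
  · exact Or.inl (eq_univ_iff_forall.1 huniv)

theorem exists_boundaryFrame (hγ : IsArcLengthBoundary S L γ) (hconv : Convex ℝ S)
    (hcomp : IsCompact S) (hint : (interior S).Nonempty) :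
    ∃ T ν κ, BoundaryFrame S L γ T ν κ := by
  rcases hγ.isOuterNormal_quarterTurn_or_neg hconv hcomp hint with h | h
  · exact ⟨_, _, _, hγ.boundaryFrame hconv hcomp hint (J := quarterTurn) inner_quarterTurn_self
      quarterTurn_quarterTurn h⟩
  · exact ⟨_, _, _, hγ.boundaryFrame hconv hcomp hint (J := -quarterTurn)
      (fun v => by simp [inner_quarterTurn_self]) (fun v => by simp [quarterTurn_quarterTurn]) h⟩

end IsArcLengthBoundary

end ExistsBoundaryFrame

section FlatArcs

/-! ### Flat and circular arcs of the boundary -/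

section NormedSpace

variable {E : Type*} [NormedAddCommGroup E] [NormedSpace ℝ E]

lemma eq_of_hasDerivAt_zero {I : Set ℝ} (hI : Convex ℝ I) {f : ℝ → E}
    (hf : ∀ x ∈ I, HasDerivAt f 0 x) {a b : ℝ} (ha : a ∈ I) (hb : b ∈ I) : f b = f a := by
  have hbound : ‖f b - f a‖ ≤ 0 * ‖b - a‖ :=
    hI.norm_image_sub_le_of_norm_hasDerivWithin_le (fun x hx => (hf x hx).hasDerivWithinAt)
      (fun _ _ => norm_zero.le) ha hb
  rw [zero_mul, norm_le_zero_iff] at hbound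
  exact sub_eq_zero.1 hbound

lemma image_Icc_subset_segment {f : ℝ → E} (hf : Continuous f) {a b : ℝ} (hab : a ≤ b)
    (hinj : InjOn f (Icc a b)) (hseg : openSegment ℝ (f a) (f b) ⊆ f '' Icc a b) :
    f '' Icc a b ⊆ segment ℝ (f a) (f b) := by
  set arc : Icc a b → E := fun u => f u
  have hemb : IsClosedEmbedding arc :=
    (hf.comp continuous_subtype_val).isClosedEmbedding hinj.injective
  have hsub : segment ℝ (f a) (f b) ⊆ range arc := by
    rw [← insert_endpoints_openSegment, insert_subset_iff, insert_subset_iff]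
    refine ⟨⟨⟨a, left_mem_Icc.2 hab⟩, rfl⟩, ⟨⟨b, right_mem_Icc.2 hab⟩, rfl⟩, fun z hz => ?_⟩
    obtain ⟨u, hu, rfl⟩ := hseg hz
    exact ⟨⟨u, hu⟩, rfl⟩
  -- The parameters of the points on the segment form a connected set that contains both ends.
  have hpre : IsPreconnected (arc ⁻¹' segment ℝ (f a) (f b)) := by
    rw [← hemb.isInducing.isPreconnected_image, image_preimage_eq_of_subset hsub]
    exact (convex_segment _ _).isPreconnected
  have hIcc := (hpre.image _ continuous_subtype_val.continuousOn).Icc_subset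
    ⟨⟨a, left_mem_Icc.2 hab⟩, left_mem_segment ℝ _ _, rfl⟩
    ⟨⟨b, right_mem_Icc.2 hab⟩, right_mem_segment ℝ _ _, rfl⟩
  rintro _ ⟨u, hu, rfl⟩
  obtain ⟨v, hv, rfl⟩ := hIcc hu
  exact hv

end NormedSpace

lemma inner_sub_eq_zero_of_mem_segment {E : Type*} [NormedAddCommGroup E] [InnerProductSpace ℝ E]
    {x y z m : E} (h : ⟪y - x, m⟫ = 0) (hz : z ∈ segment ℝ x y) : ⟪z - x, m⟫ = 0 := by
  rw [segment_eq_image'] at hz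
  obtain ⟨θ, -, rfl⟩ := hz
  rw [add_sub_cancel_left, inner_smul_left, h, mul_zero]

namespace BoundaryFrame

variable {S : Set Plane} {L : ℝ} {γ T ν : ℝ → Plane} {κ : ℝ → ℝ} {a b s : ℝ}

lemma injOn_Icc (F : BoundaryFrame S L γ T ν κ) (h : b < a + L) : InjOn γ (Icc a b) := by
  intro u hu v hv huv
  rcases lt_trichotomy u v with hlt | heq | hlt
  · exact absurd huv (F.curve_ne u v hlt (by linarith [hu.1, hv.2]))
  · exact heq
  · exact absurd huv.symm (F.curve_ne v u hlt (by linarith [hv.1, hu.2]))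

lemma exists_mem_Ico (F : BoundaryFrame S L γ T ν κ) {z : Plane} (hz : z ∈ frontier S) (a : ℝ) :
    ∃ u ∈ Ico a (a + L), γ u = z := by
  rw [← F.range_eq] at hz
  obtain ⟨v, rfl⟩ := hz
  obtain ⟨u, hu, huv⟩ := F.periodic.exists_mem_Ico F.L_pos v a
  exact ⟨u, hu, huv.symm⟩

lemma curv_eq_zero_of_inner_eq_zero (F : BoundaryFrame S L γ T ν κ) (hab : a < b)
    {c m : Plane} (hm : m ≠ 0) (h : ∀ u ∈ Icc a b, ⟪γ u - c, m⟫ = 0) :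
    ∀ u ∈ Icc a b, κ u = 0 := by
  have hT : ∀ u ∈ Ioo a b, ⟪T u, m⟫ = 0 := fun u hu => by
    have hconst : (fun _ => 0) =ᶠ[𝓝 u] fun u => ⟪γ u - c, m⟫ := by
      filter_upwards [Icc_mem_nhds hu.1 hu.2] with v hv using (h v hv).symm
    exact ((F.hasDerivAt_inner_curve c m u).congr_of_eventuallyEq hconst).unique
      (hasDerivAt_const u 0)
  have hκν : ∀ u ∈ Ioo a b, -κ u * ⟪ν u, m⟫ = 0 := fun u hu => by
    have hconst : (fun _ => 0) =ᶠ[𝓝 u] fun u => ⟪T u, m⟫ := by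
      filter_upwards [Ioo_mem_nhds hu.1 hu.2] with v hv using (hT v hv).symm
    exact ((F.hasDerivAt_inner_tangent m u).congr_of_eventuallyEq hconst).unique
      (hasDerivAt_const u 0)
  have hκ : ∀ u ∈ Ioo a b, κ u = 0 := fun u hu => by
    have hν : ⟪ν u, m⟫ ≠ 0 := fun hν => hm <| by
      rw [eq_inner_smul_add_inner_smul (F.norm_tangent u) (F.norm_normal u) (F.orth u) m,
        real_inner_comm, hT u hu, real_inner_comm, hν, zero_smul, zero_smul, add_zero]
    simpa [hν] using hκν u hu
  have hclosure : closure (Ioo a b) ⊆ {u | κ u = 0} :=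
    closure_minimal hκ (isClosed_eq F.continuous_curv continuous_const)
  rwa [closure_Ioo hab.ne] at hclosure

lemma segment_subset_frontier (F : BoundaryFrame S L γ T ν κ) (h : ⟪γ b - γ a, ν a⟫ = 0) :
    segment ℝ (γ a) (γ b) ⊆ frontier S := by
  intro z hz
  refine ⟨subset_closure (F.convex.segment_subset (F.curve_mem a) (F.curve_mem b) hz),
    notMem_interior_of_support (F.contactFrame a).n_ne_zero fun y hy => ?_⟩
  rw [← sub_sub_sub_cancel_right y z (γ a), inner_sub_left,
    inner_sub_eq_zero_of_mem_segment h hz, sub_zero]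
  exact F.support a y hy

lemma openSegment_subset_arc (F : BoundaryFrame S L γ T ν κ) (hab : a < b) (hba : b < a + L)
    (h : ⟪γ b - γ a, ν a⟫ = 0) :
    openSegment ℝ (γ a) (γ b) ⊆ γ '' Icc a b ∨
      openSegment ℝ (γ a) (γ b) ⊆ γ '' Icc b (a + L) := by
  have hne := F.curve_ne a b hab hba
  have hclosed : ∀ x y, IsClosed (γ '' Icc x y) := fun x y =>
    (isCompact_Icc.image F.continuous_curve).isClosed
  have hcover : openSegment ℝ (γ a) (γ b) ⊆ γ '' Icc a b ∪ γ '' Icc b (a + L) := by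
    intro z hz
    obtain ⟨u, hu, rfl⟩ :=
      F.exists_mem_Ico (F.segment_subset_frontier h (openSegment_subset_segment ℝ _ _ hz)) a
    exact (le_total u b).imp (fun hub => ⟨u, ⟨hu.1, hub⟩, rfl⟩) fun hub => ⟨u, ⟨hub, hu.2.le⟩, rfl⟩
  have hdisj : openSegment ℝ (γ a) (γ b) ∩ (γ '' Icc a b ∩ γ '' Icc b (a + L)) = ∅ := by
    rw [eq_empty_iff_forall_notMem]
    rintro z ⟨hz, ⟨u, hu, rfl⟩, v, hv, hvu⟩
    have hau : a ≠ u := by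
      rintro rfl
      exact hne (left_mem_openSegment_iff.1 hz)
    have hub : u ≠ b := by
      rintro rfl
      exact hne (right_mem_openSegment_iff.1 hz)
    have hau' := lt_of_le_of_ne hu.1 hau
    exact F.curve_ne u v ((lt_of_le_of_ne hu.2 hub).trans_le hv.1) (by linarith [hv.2]) hvu.symm
  exact isPreconnected_iff_subset_of_disjoint_closed.1 (convex_openSegment _ _).isPreconnected
    _ _ (hclosed _ _) (hclosed _ _) hcover hdisj

theorem curv_eq_zero_of_common_support (F : BoundaryFrame S L γ T ν κ) (hab : a < b)
    (hba : b < a + L) (h : ⟪γ b - γ a, ν a⟫ = 0) :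
    (∀ u ∈ Icc a b, κ u = 0) ∨ ∀ u ∈ Icc b (a + L), κ u = 0 := by
  have hν : ν a ≠ 0 := (F.contactFrame a).n_ne_zero
  refine (F.openSegment_subset_arc hab hba h).imp (fun harc => ?_) fun harc => ?_
  · exact F.curv_eq_zero_of_inner_eq_zero hab hν fun u hu => inner_sub_eq_zero_of_mem_segment h <|
      image_Icc_subset_segment F.continuous_curve hab.le (F.injOn_Icc hba) harc ⟨u, hu, rfl⟩
  · rw [openSegment_symm, ← F.periodic a] at harc
    have hsub := image_Icc_subset_segment F.continuous_curve hba.le (F.injOn_Icc (by linarith)) harc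
    rw [segment_symm, F.periodic a] at hsub
    exact F.curv_eq_zero_of_inner_eq_zero hba hν fun u hu =>
      inner_sub_eq_zero_of_mem_segment h (hsub ⟨u, hu, rfl⟩)

lemma inner_neg_of_curv_ne_zero (F : BoundaryFrame S L γ T ν κ) (hκ : κ a ≠ 0)
    (hab : a < b) (hba : b < a + L) : ⟪γ b - γ a, ν a⟫ < 0 := by
  refine lt_of_le_of_ne (F.support a _ (F.curve_mem b)) fun h => ?_
  rcases F.curv_eq_zero_of_common_support hab hba h with h | h
  · exact hκ (h a (left_mem_Icc.2 hab.le))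
  · exact hκ (F.periodic_curv a ▸ h (a + L) (right_mem_Icc.2 hba.le))

lemma tangent_eq_of_curv_eq_zero (F : BoundaryFrame S L γ T ν κ) {I : Set ℝ} (hI : Convex ℝ I)
    (h : ∀ u ∈ I, κ u = 0) (ha : a ∈ I) (hb : b ∈ I) : T b = T a :=
  eq_of_hasDerivAt_zero hI (fun x hx => by simpa [h x hx] using F.deriv_tangent x) ha hb

lemma curve_eq_of_curv_eq_zero (F : BoundaryFrame S L γ T ν κ) {I : Set ℝ} (hI : Convex ℝ I)
    (h : ∀ u ∈ I, κ u = 0) (ha : a ∈ I) (hb : b ∈ I) : γ b = γ a + (b - a) • T a := by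
  have hderiv : ∀ x ∈ I, HasDerivAt (fun x => γ x - (x - a) • T a) 0 x := fun x hx =>
    ((F.deriv_curve x).sub (((hasDerivAt_id x).sub_const a).smul_const (T a))).congr_deriv
      (by rw [F.tangent_eq_of_curv_eq_zero hI h ha hx, one_smul, sub_self])
  simpa [sub_eq_iff_eq_add] using eq_of_hasDerivAt_zero hI hderiv ha hb

lemma exists_curv_ne_zero (F : BoundaryFrame S L γ T ν κ) : ∃ u, κ u ≠ 0 := by
  by_contra! h
  have hline := F.curve_eq_of_curv_eq_zero convex_univ (fun u _ => h u) (mem_univ 0) (mem_univ L)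
  have hT : T 0 ≠ 0 := ne_zero_of_norm_ne_zero (F.norm_tangent 0 ▸ one_ne_zero)
  rw [← zero_add L, F.periodic 0] at hline
  simp [hT, F.L_pos.ne'] at hline

lemma mem_flatPiece_of_curv_eq_zero (F : BoundaryFrame S L γ T ν κ)
    (h : ∀ u ∈ uIcc a b, κ u = 0) : γ b ∈ flatPiece S (γ a) := by
  have hγ : ∀ u ∈ uIcc a b, γ u = γ a + (u - a) • T a := fun u hu =>
    F.curve_eq_of_curv_eq_zero (convex_uIcc a b) h left_mem_uIcc hu
  intro z hz
  rw [segment_eq_image'] at hz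
  obtain ⟨θ, hθ, rfl⟩ := hz
  have hmem : a + θ • (b - a) ∈ uIcc a b := by
    rw [← segment_eq_uIcc, segment_eq_image']
    exact ⟨θ, hθ, rfl⟩
  have hpoint : γ (a + θ • (b - a)) = γ a + θ • (γ b - γ a) := by
    rw [hγ b right_mem_uIcc, hγ _ hmem, smul_eq_mul]
    module
  exact mem_of_eq_of_mem hpoint.symm (F.curve_mem_frontier _)

-- On an arc of constant curvature `k` the frame rotated back by the angle `k * u` is constant.
lemma normal_of_const_curv (F : BoundaryFrame S L γ T ν κ) {η k : ℝ}
    (hκ : ∀ u ∈ Ioo (s - η) (s + η), κ u = k) {u : ℝ} (hu : |u| < η) :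
    ν (s + u) = Real.sin (k * u) • T s + Real.cos (k * u) • ν s := by
  have hκ' : ∀ v ∈ Ioo (-η) η, κ (s + v) = k := fun v hv =>
    hκ _ ⟨by linarith [hv.1], by linarith [hv.2]⟩
  have hu' : u ∈ Ioo (-η) η := abs_lt.1 hu
  have h0 : (0 : ℝ) ∈ Ioo (-η) η := abs_lt.1 (by rw [abs_zero]; exact (abs_nonneg u).trans_lt hu)
  have hT := fun v => (F.deriv_tangent (s + v)).comp_const_add s v
  have hν := fun v => (F.deriv_normal (s + v)).comp_const_add s v
  have hcos := fun v => ((hasDerivAt_id v).const_mul k).cos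
  have hsin := fun v => ((hasDerivAt_id v).const_mul k).sin
  have htangent : Real.cos (k * u) • T (s + u) + Real.sin (k * u) • ν (s + u) = T s := by
    simpa using eq_of_hasDerivAt_zero (convex_Ioo (-η) η)
      (f := fun v => Real.cos (k * v) • T (s + v) + Real.sin (k * v) • ν (s + v))
      (fun v hv => (((hcos v).smul (hT v)).add ((hsin v).smul (hν v))).congr_deriv
        (by rw [hκ' v hv]; simp only [id]; module)) h0 hu'
  have hnormal : -Real.sin (k * u) • T (s + u) + Real.cos (k * u) • ν (s + u) = ν s := by
    simpa using eq_of_hasDerivAt_zero (convex_Ioo (-η) η)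
      (f := fun v => -Real.sin (k * v) • T (s + v) + Real.cos (k * v) • ν (s + v))
      (fun v hv => (((hsin v).neg.smul (hT v)).add ((hcos v).smul (hν v))).congr_deriv
        (by rw [hκ' v hv]; simp only [id, Pi.neg_apply]; module)) h0 hu'
  calc ν (s + u) = (Real.sin (k * u) ^ 2 + Real.cos (k * u) ^ 2) • ν (s + u) := by
        rw [Real.sin_sq_add_cos_sq, one_smul]
    _ = Real.sin (k * u) • T s + Real.cos (k * u) • ν s := by
        rw [← htangent, ← hnormal]
        module

-- On an arc of constant curvature `k` the vector `ν - k • γ` is constant.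
lemma curve_of_const_curv (F : BoundaryFrame S L γ T ν κ) {η k : ℝ} (hk : k ≠ 0)
    (hκ : ∀ u ∈ Ioo (s - η) (s + η), κ u = k) {u : ℝ} (hu : |u| < η) :
    γ (s + u) - γ s = (Real.sin (k * u) / k) • T s + ((Real.cos (k * u) - 1) / k) • ν s := by
  have hη : 0 < η := (abs_nonneg u).trans_lt hu
  have hderiv : ∀ v ∈ Ioo (s - η) (s + η), HasDerivAt (fun v => ν v - k • γ v) 0 v :=
    fun v hv => ((F.deriv_normal v).sub ((F.deriv_curve v).const_smul k)).congr_deriv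
      (by rw [hκ v hv, sub_self])
  have hcenter : ν (s + u) - k • γ (s + u) = ν s - k • γ s :=
    eq_of_hasDerivAt_zero (convex_Ioo _ _) hderiv ⟨by linarith, by linarith⟩
      ⟨by linarith [neg_lt_of_abs_lt hu], by linarith [lt_of_abs_lt hu]⟩
  have hscaled : k • (γ (s + u) - γ s) =
      Real.sin (k * u) • T s + (Real.cos (k * u) - 1) • ν s := by
    calc k • (γ (s + u) - γ s) = ν (s + u) - ν s := by
          rw [smul_sub, sub_eq_sub_iff_add_eq_add, add_comm, ← sub_eq_sub_iff_add_eq_add]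
          exact hcenter.symm
      _ = _ := by
          rw [F.normal_of_const_curv hκ hu]
          module
  rw [div_eq_inv_mul, div_eq_inv_mul, mul_smul, mul_smul, ← smul_add, ← hscaled,
    inv_smul_smul₀ hk]

end BoundaryFrame

end FlatArcs

section SlopesNearBoundary

/-! ### The slopes close to the boundary -/

lemma isLittleO_pow_succ_of_deriv {f f' : ℝ → ℝ} (hf : ∀ u, HasDerivAt f (f' u) u) (h0 : f 0 = 0)
    {n : ℕ} (h : f' =o[𝓝 0] fun u => u ^ n) : f =o[𝓝 0] fun u => u ^ (n + 1) := by
  rw [isLittleO_iff] at h ⊢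
  intro c hc
  obtain ⟨r, hr, hball⟩ := Metric.eventually_nhds_iff.1 (h hc)
  refine Metric.eventually_nhds_iff.2 ⟨r, hr, fun u hu => ?_⟩
  have hmvt : ‖f u - f 0‖ ≤ (c * |u| ^ n) * ‖u - 0‖ := by
    refine (convex_uIcc 0 u).norm_image_sub_le_of_norm_hasDerivWithin_le
      (fun x _ => (hf x).hasDerivWithinAt) (fun x hx => ?_) left_mem_uIcc right_mem_uIcc
    have hxu : |x| ≤ |u| := by simpa using abs_sub_left_of_mem_uIcc hx
    have hxr : dist x 0 < r := (by simpa using hxu : dist x 0 ≤ dist u 0).trans_lt hu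
    have hf'x := hball hxr
    rw [norm_pow, Real.norm_eq_abs x] at hf'x
    exact hf'x.trans (by gcongr)
  rw [h0, sub_zero, sub_zero] at hmvt
  rwa [norm_pow, pow_succ, ← mul_assoc]

lemma isLittleO_pow_one_of_hasDerivAt {f : ℝ → ℝ} (hf : HasDerivAt f 0 0) (h0 : f 0 = 0) :
    f =o[𝓝 0] fun u => u ^ 1 := by
  simpa [h0] using hasDerivAt_iff_isLittleO.1 hf

lemma isLittleO_even_part {f f₁ f₂ : ℝ → ℝ} (h₁ : ∀ u, HasDerivAt f (f₁ u) u)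
    (h₂ : ∀ u, HasDerivAt f₁ (f₂ u) u) {s c : ℝ} (h₃ : HasDerivAt f₂ c s) (hs : f s = 0)
    (hs₂ : f₂ s = 0) : (fun u => f (s + u) + f (s - u)) =o[𝓝 0] fun u => u ^ 3 := by
  have hderiv : ∀ u, HasDerivAt (fun u => f (s + u) + f (s - u)) (f₁ (s + u) - f₁ (s - u)) u :=
    fun u => ((h₁ (s + u)).comp_const_add s u).add ((h₁ (s - u)).comp_const_sub s u)
  have hderiv₁ : ∀ u, HasDerivAt (fun u => f₁ (s + u) - f₁ (s - u)) (f₂ (s + u) + f₂ (s - u)) u :=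
    fun u => (((h₂ (s + u)).comp_const_add s u).sub ((h₂ (s - u)).comp_const_sub s u)).congr_deriv
      (sub_neg_eq_add _ _)
  have hderiv₂ : HasDerivAt (fun u => f₂ (s + u) + f₂ (s - u)) 0 0 :=
    ((HasDerivAt.comp_const_add s 0 (by rwa [add_zero])).add
      (HasDerivAt.comp_const_sub s 0 (by rwa [sub_zero]))).congr_deriv (add_neg_cancel c)
  exact isLittleO_pow_succ_of_deriv hderiv (by simp [hs]) <|
    isLittleO_pow_succ_of_deriv hderiv₁ (by simp) <|
      isLittleO_pow_one_of_hasDerivAt hderiv₂ (by simp [hs₂])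

lemma isLittleO_odd_part {f f₁ f₂ : ℝ → ℝ} (h₁ : ∀ u, HasDerivAt f (f₁ u) u)
    (h₂ : ∀ u, HasDerivAt f₁ (f₂ u) u) {s c : ℝ} (h₃ : HasDerivAt f₂ c s) (hs₁ : f₁ s = 0) :
    (fun u => f (s + u) - f (s - u) - c / 3 * u ^ 3) =o[𝓝 0] fun u => u ^ 3 := by
  have hderiv : ∀ u, HasDerivAt (fun u => f (s + u) - f (s - u) - c / 3 * u ^ 3)
      (f₁ (s + u) + f₁ (s - u) - c * u ^ 2) u := fun u =>
    ((((h₁ (s + u)).comp_const_add s u).sub ((h₁ (s - u)).comp_const_sub s u)).sub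
      ((hasDerivAt_pow 3 u).const_mul (c / 3))).congr_deriv (by push_cast; ring)
  have hderiv₁ : ∀ u, HasDerivAt (fun u => f₁ (s + u) + f₁ (s - u) - c * u ^ 2)
      (f₂ (s + u) - f₂ (s - u) - 2 * c * u) u := fun u =>
    ((((h₂ (s + u)).comp_const_add s u).add ((h₂ (s - u)).comp_const_sub s u)).sub
      ((hasDerivAt_pow 2 u).const_mul c)).congr_deriv (by push_cast; ring)
  have hderiv₂ : HasDerivAt (fun u => f₂ (s + u) - f₂ (s - u) - 2 * c * u) 0 0 :=
    (((HasDerivAt.comp_const_add s 0 (f := f₂) (f' := c) (by rwa [add_zero])).sub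
      (HasDerivAt.comp_const_sub s 0 (f := f₂) (f' := c) (by rwa [sub_zero]))).sub
      ((hasDerivAt_id (0 : ℝ)).const_mul (2 * c))).congr_deriv (by ring)
  exact isLittleO_pow_succ_of_deriv hderiv (by simp) <|
    isLittleO_pow_succ_of_deriv hderiv₁ (by simp [hs₁]) <|
      isLittleO_pow_one_of_hasDerivAt hderiv₂ (by simp)

lemma tendsto_sqrt_nhdsGT_zero : Tendsto Real.sqrt (𝓝[>] 0) (𝓝[>] 0) :=
  tendsto_nhdsWithin_iff.2 ⟨Real.continuous_sqrt.continuousWithinAt.tendsto.mono_right (by simp),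
    eventually_mem_nhdsWithin.mono fun _ ht => Real.sqrt_pos.2 ht⟩

namespace BoundaryFrame

variable {S : Set Plane} {L : ℝ} {γ T ν : ℝ → Plane} {κ : ℝ → ℝ} {s η k : ℝ}

lemma norm_curve_sub_le (F : BoundaryFrame S L γ T ν κ) (s u : ℝ) : ‖γ u - γ s‖ ≤ |u - s| := by
  simpa using convex_univ.norm_image_sub_le_of_norm_hasDerivWithin_le
    (fun x _ => (F.deriv_curve x).hasDerivWithinAt) (fun x _ => (F.norm_tangent x).le)
    (mem_univ s) (mem_univ u)

lemma abs_inner_curve_le (F : BoundaryFrame S L γ T ν κ) (s u : ℝ) {m : Plane} (hm : ‖m‖ = 1) :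
    |⟪γ (s + u) - γ s, m⟫| ≤ |u| := by
  simpa [hm] using (abs_real_inner_le_norm (γ (s + u) - γ s) m).trans
    (mul_le_mul_of_nonneg_right (F.norm_curve_sub_le s (s + u)) (norm_nonneg m))

lemma eventually_abs_inner_tangent_sub_le (F : BoundaryFrame S L γ T ν κ) (s : ℝ) :
    ∀ᶠ u in 𝓝 (0 : ℝ), |⟪γ (s + u) - γ s, T s⟫ - u| ≤ |u| / 2 := by
  have hderiv : HasDerivAt (fun u => ⟪γ (s + u) - γ s, T s⟫) (1 : ℝ) 0 := by
    simpa [F.norm_tangent] using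
      (F.hasDerivAt_inner_curve (γ s) (T s) (s + 0)).comp_const_add s 0
  filter_upwards [isLittleO_iff.1 (hasDerivAt_iff_isLittleO.1 hderiv) (half_pos one_pos)]
    with u hu
  simpa [div_eq_inv_mul] using hu

lemma eventually_depth_le (F : BoundaryFrame S L γ T ν κ) (s : ℝ) :
    ∀ᶠ u in 𝓝 (0 : ℝ), -⟪γ (s + u) - γ s, ν s⟫ ≤ (κ s / 2 + 1) * u ^ 2 := by
  have hderiv : ∀ u, HasDerivAt (fun u => ⟪γ (s + u) - γ s, ν s⟫ + κ s / 2 * u ^ 2)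
      (⟪T (s + u), ν s⟫ + κ s * u) u := fun u =>
    (((F.hasDerivAt_inner_curve (γ s) (ν s) (s + u)).comp_const_add s u).add
      ((hasDerivAt_pow 2 u).const_mul (κ s / 2))).congr_deriv (by push_cast; ring)
  have hderiv₁ : HasDerivAt (fun u => ⟪T (s + u), ν s⟫ + κ s * u) 0 0 :=
    (((F.hasDerivAt_inner_tangent (ν s) (s + 0)).comp_const_add s 0).add
      ((hasDerivAt_id (0 : ℝ)).const_mul (κ s))).congr_deriv
        (by simp [F.norm_normal])
  have hsmall := isLittleO_pow_succ_of_deriv hderiv (by simp)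
    (isLittleO_pow_one_of_hasDerivAt hderiv₁ (by simp [F.orth]))
  filter_upwards [isLittleO_iff.1 hsmall one_pos] with u hu
  rw [one_mul, one_add_one_eq_two, Real.norm_eq_abs, Real.norm_of_nonneg (sq_nonneg u)] at hu
  linarith [neg_le_of_abs_le hu]

lemma hasDerivAt_curv (F : BoundaryFrame S L γ T ν κ) (s : ℝ) : HasDerivAt κ (deriv κ s) s :=
  (F.contDiff_curv.differentiable one_ne_zero s).hasDerivAt

lemma isLittleO_inner_tangent (F : BoundaryFrame S L γ T ν κ) (s : ℝ) :
    (fun u => ⟪γ (s + u) - γ s, T s⟫ + ⟪γ (s - u) - γ s, T s⟫) =o[𝓝 0] fun u => u ^ 3 :=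
  isLittleO_even_part (F.hasDerivAt_inner_curve (γ s) (T s)) (F.hasDerivAt_inner_tangent (T s))
    ((F.hasDerivAt_curv s).neg.mul (F.hasDerivAt_inner_normal (T s) s)) (by simp)
    (by rw [real_inner_comm, F.orth s, mul_zero])

lemma isLittleO_inner_normal (F : BoundaryFrame S L γ T ν κ) (s : ℝ) :
    (fun u => ⟪γ (s + u) - γ s, ν s⟫ - ⟪γ (s - u) - γ s, ν s⟫ - -deriv κ s / 3 * u ^ 3)
      =o[𝓝 0] fun u => u ^ 3 :=
  isLittleO_odd_part (F.hasDerivAt_inner_curve (γ s) (ν s)) (F.hasDerivAt_inner_tangent (ν s))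
    (((F.hasDerivAt_curv s).neg.mul (F.hasDerivAt_inner_normal (ν s) s)).congr_deriv
      (by simp [F.orth s, F.norm_normal s])) (F.orth s)

-- Increasing curvature makes the forward arc fall off faster than the backward arc.
lemma eventually_sightSlope_lt (F : BoundaryFrame S L γ T ν κ) (hκ' : 0 < deriv κ s) :
    ∀ᶠ u in 𝓝[>] (0 : ℝ), ∀ t ∈ Ioc 0 u,
      sightSlope (γ s) (T s) (ν s) t (γ (s + u)) <
        sightSlope (γ s) (-T s) (ν s) t (γ (s - u)) := by
  have hT := isLittleO_iff.1 (F.isLittleO_inner_tangent s) (c := deriv κ s / 48) (by positivity)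
  have hν := isLittleO_iff.1 (F.isLittleO_inner_normal s) (c := deriv κ s / 6) (by positivity)
  have hspeed := (continuous_neg.tendsto' (0 : ℝ) 0 neg_zero).eventually
    (F.eventually_abs_inner_tangent_sub_le s)
  filter_upwards [nhdsWithin_le_nhds hT, nhdsWithin_le_nhds hν, nhdsWithin_le_nhds hspeed,
    self_mem_nhdsWithin] with u hTu hνu hspeedu (hu : 0 < u) t ⟨ht, htu⟩
  have hdepth := F.abs_inner_curve_le s (-u) (F.norm_normal s)
  rw [Real.norm_eq_abs, Real.norm_of_nonneg (pow_pos hu 3).le] at hTu hνu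
  rw [← sub_eq_add_neg, abs_neg, abs_of_pos hu] at hspeedu hdepth
  have hpos := (F.contactFrame s).depth_pos ht (F.curve_mem (s + u))
  have hpos' := (F.contactFrame s).depth_pos ht (F.curve_mem (s - u))
  rw [sightSlope, sightSlope, inner_neg_right, div_lt_div_iff₀ hpos hpos']
  set k := deriv κ s
  set X := ⟪γ (s + u) - γ s, T s⟫
  set X' := ⟪γ (s - u) - γ s, T s⟫
  set Y := ⟪γ (s + u) - γ s, ν s⟫
  set Y' := ⟪γ (s - u) - γ s, ν s⟫
  have hX : X + X' ≤ k / 48 * u ^ 3 := le_of_abs_le hTu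
  have hY : k / 6 * u ^ 3 ≤ Y' - Y := by linarith [le_of_abs_le hνu]
  have hX' : u / 2 ≤ -X' := by linarith [le_of_abs_le hspeedu]
  have hY' : -Y' ≤ u := by linarith [neg_le_of_abs_le hdepth]
  have hsum : (X + X') * (t - Y') ≤ (k / 48 * u ^ 3) * (2 * u) :=
    (mul_le_mul_of_nonneg_right hX hpos'.le).trans
      (mul_le_mul_of_nonneg_left (by linarith) (by positivity))
  have hdiff : (u / 2) * (k / 6 * u ^ 3) ≤ -X' * (Y' - Y) :=
    mul_le_mul hX' hY (by positivity) (by linarith)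
  have hgap : 0 < k * u ^ 4 := by positivity
  linear_combination hsum + hdiff + hgap / 24

lemma exists_sightSlope_curve_eq (F : BoundaryFrame S L γ T ν κ) (s : ℝ) {t : ℝ} (ht : 0 < t) :
    ∃ u ∈ Icc (-(L / 2)) (L / 2), sightSlope (γ s) (T s) (ν s) t (γ (s + u)) =
      upperSlope S (γ s) (T s) (ν s) t := by
  have C := F.contactFrame s
  obtain ⟨y, hy, hyq⟩ := C.exists_sightSlope_eq F.compact ht
  set q := upperSlope S (γ s) (T s) (ν s) t
  set m := T s + q • ν s
  have hmT : ⟪m, T s⟫ = 1 := by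
    simp [m, inner_add_left, inner_smul_left, real_inner_comm (T s) (ν s), C.orth, C.norm_e]
  have hmν : ⟪m, ν s⟫ = q := by
    simp [m, inner_add_left, inner_smul_left, C.orth, C.norm_n]
  have hm : m ≠ 0 := fun h0 => by
    rw [h0, inner_zero_left] at hmT
    exact zero_ne_one hmT
  have hinner : ∀ y' ∈ S, ⟪y' - (γ s + t • ν s), m⟫ =
      (t - ⟪y' - γ s, ν s⟫) * (sightSlope (γ s) (T s) (ν s) t y' - q) := fun y' hy' => by
    rw [C.inner_sub_eq ht hy' m, hmT, hmν, one_mul]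
  have hfrontier : y ∈ frontier S := by
    refine ⟨subset_closure hy, notMem_interior_of_support hm fun y' hy' => ?_⟩
    rw [← sub_sub_sub_cancel_right y' y (γ s + t • ν s), inner_sub_left, hinner y hy, hyq,
      sub_self, mul_zero, sub_zero, hinner y' hy']
    exact mul_nonpos_of_nonneg_of_nonpos (C.depth_pos ht hy').le
      (sub_nonpos.2 (C.sightSlope_le F.compact ht hy'))
  obtain ⟨v, hv, rfl⟩ := F.exists_mem_Ico hfrontier (s - L / 2)
  exact ⟨v - s, ⟨by linarith [hv.1], by linarith [hv.2]⟩, by rwa [add_sub_cancel]⟩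

lemma exists_le_upperSlope_mul_sqrt (F : BoundaryFrame S L γ T ν κ) (s : ℝ) :
    ∃ c > 0, ∀ᶠ t in 𝓝[>] 0, c ≤ upperSlope S (γ s) (T s) (ν s) t * √t := by
  have hκ := F.curv_nonneg s
  have hlocal : ∀ᶠ u in 𝓝[>] (0 : ℝ), _ := nhdsWithin_le_nhds <|
    (F.eventually_abs_inner_tangent_sub_le s).and (F.eventually_depth_le s)
  refine ⟨1 / (κ s + 4), by positivity, ?_⟩
  filter_upwards [tendsto_sqrt_nhdsGT_zero.eventually hlocal, self_mem_nhdsWithin]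
    with t ⟨hT, hν⟩ (ht : 0 < t)
  have C := F.contactFrame s
  have hsqrt : 0 < √t := Real.sqrt_pos.2 ht
  refine le_trans ?_
    (mul_le_mul_of_nonneg_right (C.sightSlope_le F.compact ht (F.curve_mem (s + √t))) hsqrt.le)
  rw [abs_of_pos hsqrt] at hT
  rw [Real.sq_sqrt ht.le] at hν
  have hX : √t / 2 ≤ ⟪γ (s + √t) - γ s, T s⟫ := by linarith [neg_le_of_abs_le hT]
  have hXt : t / 2 ≤ ⟪γ (s + √t) - γ s, T s⟫ * √t := by
    calc t / 2 = √t / 2 * √t := by rw [div_mul_eq_mul_div, Real.mul_self_sqrt ht.le]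
      _ ≤ _ := mul_le_mul_of_nonneg_right hX hsqrt.le
  rw [sightSlope, div_mul_eq_mul_div,
    div_le_div_iff₀ (by positivity) (C.depth_pos ht (F.curve_mem _))]
  nlinarith

lemma exists_depth_ge (F : BoundaryFrame S L γ T ν κ) (hκ : κ s ≠ 0) (hη : 0 < η) :
    ∃ m > 0, ∀ u ∈ Icc (-(L / 2)) (L / 2), η ≤ |u| → m ≤ -⟪γ (s + u) - γ s, ν s⟫ := by
  have hcont : Continuous fun u => -⟪γ (s + u) - γ s, ν s⟫ := by
    have hγ := F.continuous_curve
    fun_prop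
  have hcompact : IsCompact (Icc (-(L / 2)) (L / 2) ∩ {u | η ≤ |u|}) :=
    isCompact_Icc.inter_right (isClosed_le continuous_const continuous_abs)
  have hpos : ∀ u ∈ Icc (-(L / 2)) (L / 2) ∩ {u | η ≤ |u|}, 0 < -⟪γ (s + u) - γ s, ν s⟫ := by
    rintro u ⟨⟨hLu, huL⟩, hu : η ≤ |u|⟩
    rcases le_abs'.1 hu with hu | hu
    · have hneg := F.inner_neg_of_curv_ne_zero hκ (b := s + u + L) (by linarith) (by linarith)
      rwa [F.periodic, ← neg_pos] at hneg
    · exact neg_pos.2 (F.inner_neg_of_curv_ne_zero hκ (by linarith) (by linarith))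
  obtain ⟨m, hm, hle⟩ := hcompact.exists_forall_le' hcont.continuousOn hpos
  exact ⟨m, hm, fun u hu hηu => hle u ⟨hu, hηu⟩⟩

lemma eventually_abs_lt_of_sightSlope_eq (F : BoundaryFrame S L γ T ν κ) (hκ : κ s ≠ 0)
    (hη : 0 < η) : ∀ᶠ t in 𝓝[>] 0, ∀ u ∈ Icc (-(L / 2)) (L / 2),
      sightSlope (γ s) (T s) (ν s) t (γ (s + u)) = upperSlope S (γ s) (T s) (ν s) t → |u| < η := by
  obtain ⟨c, hc, hslope⟩ := F.exists_le_upperSlope_mul_sqrt s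
  obtain ⟨m, hm, hdepth⟩ := F.exists_depth_ge hκ hη
  have hsmall : ∀ᶠ t in 𝓝[>] (0 : ℝ), L / 2 * √t < c * m := by
    have hlim : Tendsto (fun t => L / 2 * √t) (𝓝[>] 0) (𝓝 (L / 2 * 0)) :=
      (tendsto_nhds_of_tendsto_nhdsWithin tendsto_sqrt_nhdsGT_zero).const_mul _
    exact hlim.eventually_lt_const (by rw [mul_zero]; positivity)
  filter_upwards [hslope, hsmall, self_mem_nhdsWithin] with t hslope hsmall (ht : 0 < t) u hu huq
  by_contra! hηu
  have hpos := (F.contactFrame s).depth_pos ht (F.curve_mem (s + u))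
  rw [sightSlope, div_eq_iff hpos.ne'] at huq
  set R := upperSlope S (γ s) (T s) (ν s) t
  have hR : 0 < R := pos_of_mul_pos_left (hc.trans_le hslope) (Real.sqrt_nonneg t)
  refine hsmall.not_ge ?_
  calc c * m ≤ R * √t * m := by gcongr
    _ = R * m * √t := by ring
    _ ≤ R * (t - ⟪γ (s + u) - γ s, ν s⟫) * √t := by
      gcongr
      linarith [hdepth u hu hηu]
    _ = ⟪γ (s + u) - γ s, T s⟫ * √t := by rw [huq]
    _ ≤ L / 2 * √t := by
      gcongr
      exact (le_of_abs_le (F.abs_inner_curve_le s u (F.norm_tangent s))).trans (abs_le.2 hu)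

theorem eventually_exists_sightSlope_eq (F : BoundaryFrame S L γ T ν κ) (hκ : κ s ≠ 0)
    (hη : 0 < η) : ∀ᶠ t in 𝓝[>] 0, ∃ u ∈ Ioo 0 η, t ≤ u ∧
      sightSlope (γ s) (T s) (ν s) t (γ (s + u)) = upperSlope S (γ s) (T s) (ν s) t := by
  obtain ⟨r, hr, hspeed⟩ := Metric.eventually_nhds_iff.1 (F.eventually_abs_inner_tangent_sub_le s)
  simp only [Real.dist_eq, sub_zero] at hspeed
  obtain ⟨c, hc, hslope⟩ := F.exists_le_upperSlope_mul_sqrt s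
  have hsqrt : ∀ᶠ t in 𝓝[>] (0 : ℝ), √t < c :=
    (tendsto_nhds_of_tendsto_nhdsWithin tendsto_sqrt_nhdsGT_zero).eventually_lt_const hc
  filter_upwards [hslope, hsqrt, F.eventually_abs_lt_of_sightSlope_eq hκ (lt_min hη hr),
    self_mem_nhdsWithin] with t hslope hsqrt hnear (ht : 0 < t)
  obtain ⟨u, huL, huq⟩ := F.exists_sightSlope_curve_eq s ht
  obtain ⟨huη, hur⟩ := lt_min_iff.1 (hnear u huL huq)
  have hpos := (F.contactFrame s).depth_pos ht (F.curve_mem (s + u))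
  have hX := huq
  rw [sightSlope, div_eq_iff hpos.ne'] at hX
  set R := upperSlope S (γ s) (T s) (ν s) t
  have hR : 0 < R := pos_of_mul_pos_left (hc.trans_le hslope) (Real.sqrt_nonneg t)
  have hu : 0 < u := by
    by_contra! hu
    have hle := le_of_abs_le (hspeed hur)
    rw [abs_of_nonpos hu] at hle
    linarith [mul_pos hR hpos]
  refine ⟨u, ⟨hu, lt_of_abs_lt huη⟩, ?_, huq⟩
  calc t = √t * √t := (Real.mul_self_sqrt ht.le).symm
    _ ≤ R * √t * √t := by gcongr; exact hsqrt.le.trans hslope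
    _ = R * t := by rw [mul_assoc, Real.mul_self_sqrt ht.le]
    _ ≤ R * (t - ⟪γ (s + u) - γ s, ν s⟫) := by
      gcongr
      linarith [F.support s _ (F.curve_mem (s + u))]
    _ = ⟪γ (s + u) - γ s, T s⟫ := hX.symm
    _ ≤ u := (le_of_abs_le (F.abs_inner_curve_le s u (F.norm_tangent s))).trans_eq (abs_of_pos hu)

theorem eventually_upperSlope_lt (F : BoundaryFrame S L γ T ν κ) (hκ : κ s ≠ 0)
    (hκ' : 0 < deriv κ s) : ∀ᶠ t in 𝓝[>] 0,
      upperSlope S (γ s) (T s) (ν s) t < upperSlope S (γ s) (-T s) (ν s) t := by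
  obtain ⟨η, hη, hlt⟩ := mem_nhdsGT_iff_exists_Ioo_subset.1 (F.eventually_sightSlope_lt hκ')
  filter_upwards [F.eventually_exists_sightSlope_eq hκ hη, self_mem_nhdsWithin]
    with t ⟨u, hu, htu, huq⟩ (ht : 0 < t)
  exact huq ▸ (hlt hu t ⟨ht, htu⟩).trans_le
    ((F.contactFrame s).neg.sightSlope_le F.compact ht (F.curve_mem _))

theorem eventually_upperSlope_gt (F : BoundaryFrame S L γ T ν κ) (hκ : κ s ≠ 0)
    (hκ' : deriv κ s < 0) : ∀ᶠ t in 𝓝[>] 0,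
      upperSlope S (γ s) (-T s) (ν s) t < upperSlope S (γ s) (T s) (ν s) t := by
  simpa using F.reverse.eventually_upperSlope_lt (s := -s) (by simpa using hκ)
    (by rw [deriv_comp_neg, neg_neg]; exact neg_pos.2 hκ')

lemma sightSlope_reflect_of_const_curv (F : BoundaryFrame S L γ T ν κ) (hk : k ≠ 0)
    (hκ : ∀ u ∈ Ioo (s - η) (s + η), κ u = k) {u : ℝ} (hu : |u| < η) (t : ℝ) :
    sightSlope (γ s) (-T s) (ν s) t (γ (s - u)) = sightSlope (γ s) (T s) (ν s) t (γ (s + u)) := by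
  have C := F.contactFrame s
  rw [sightSlope, sightSlope, sub_eq_add_neg s u, F.curve_of_const_curv hk hκ hu,
    F.curve_of_const_curv hk hκ (by rwa [abs_neg])]
  simp only [inner_add_left, inner_smul_left, inner_neg_right, C.orth, real_inner_comm (T s) (ν s),
    real_inner_self_eq_norm_sq, C.norm_e, C.norm_n, conj_trivial, mul_neg, Real.sin_neg,
    Real.cos_neg]
  ring

lemma eventually_upperSlope_le_of_const_curv (F : BoundaryFrame S L γ T ν κ) (hk : k ≠ 0)
    (hη : 0 < η) (hκ : ∀ u ∈ Ioo (s - η) (s + η), κ u = k) : ∀ᶠ t in 𝓝[>] 0,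
      upperSlope S (γ s) (T s) (ν s) t ≤ upperSlope S (γ s) (-T s) (ν s) t := by
  have hs : κ s ≠ 0 := by rwa [hκ s ⟨by linarith, by linarith⟩]
  filter_upwards [F.eventually_exists_sightSlope_eq hs hη, self_mem_nhdsWithin]
    with t ⟨u, hu, _, huq⟩ (ht : 0 < t)
  rw [← huq, ← F.sightSlope_reflect_of_const_curv hk hκ (by rw [abs_of_pos hu.1]; exact hu.2)]
  exact (F.contactFrame s).neg.sightSlope_le F.compact ht (F.curve_mem _)

theorem eventually_upperSlope_eq_of_const_curv (F : BoundaryFrame S L γ T ν κ) (hk : k ≠ 0)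
    (hη : 0 < η) (hκ : ∀ u ∈ Ioo (s - η) (s + η), κ u = k) : ∀ᶠ t in 𝓝[>] 0,
      upperSlope S (γ s) (T s) (ν s) t = upperSlope S (γ s) (-T s) (ν s) t := by
  have hreverse := F.reverse.eventually_upperSlope_le_of_const_curv (s := -s) hk hη
    (fun u hu => hκ (-u) ⟨by linarith [hu.2], by linarith [hu.1]⟩)
  simp only [neg_neg] at hreverse
  filter_upwards [F.eventually_upperSlope_le_of_const_curv hk hη hκ, hreverse] with t hle hge
  exact le_antisymm hle hge

lemma continuousOn_upperSlope (F : BoundaryFrame S L γ T ν κ) {e : ℝ → Plane} (he : Continuous e) :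
    ContinuousOn (fun z : ℝ × ℝ => upperSlope S (γ z.1) (e z.1) (ν z.1) z.2) (univ ×ˢ Ioi 0) := by
  have hγ := F.continuous_curve
  have hν := F.continuous_normal
  -- Cutting the denominator off at `c > 0` gives a slope that is continuous on the whole plane.
  have hcut : ∀ c : ℝ, 0 < c → Continuous fun z : ℝ × ℝ =>
      sSup ((fun y => ⟪y - γ z.1, e z.1⟫ / max c (z.2 - ⟪y - γ z.1, ν z.1⟫)) '' S) := fun c hc =>
    F.compact.continuous_sSup (f := fun (z : ℝ × ℝ) y =>
      ⟪y - γ z.1, e z.1⟫ / max c (z.2 - ⟪y - γ z.1, ν z.1⟫))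
      (Continuous.div (by fun_prop) (by fun_prop) fun _ => (lt_max_of_lt_left hc).ne')
  rintro ⟨s, t⟩ ⟨-, ht : 0 < t⟩
  refine (((hcut (t / 2) (half_pos ht)).continuousAt (x := (s, t))).congr ?_).continuousWithinAt
  have hclose : ∀ᶠ z : ℝ × ℝ in 𝓝 (s, t), t / 2 < z.2 :=
    continuous_snd.continuousAt.eventually (lt_mem_nhds (half_lt_self ht))
  filter_upwards [hclose] with z hz
  refine congrArg sSup (image_congr fun y hy => ?_)
  rw [sightSlope, max_eq_right (by linarith [F.support z.1 y hy])]

end BoundaryFrame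

end SlopesNearBoundary

section FourVertices

/-! ### Four vertices on disjoint flat pieces -/

lemma exists_isLocalMax_Ioo {f : ℝ → ℝ} {a b c : ℝ} (hf : ContinuousOn f (Icc a b))
    (hc : c ∈ Icc a b) (ha : f a < f c) (hb : f b < f c) :
    ∃ y ∈ Ioo a b, IsLocalMax f y ∧ f c ≤ f y := by
  obtain ⟨y, hy, hmax⟩ := isCompact_Icc.exists_isMaxOn_mem_subset (s := Ioo a b) hf hc (by
    rw [Icc_sdiff_Ioo_same (hc.1.trans hc.2)]
    rintro z (rfl | rfl) <;> assumption)
  exact ⟨y, hy, hmax.isLocalMax (Icc_mem_nhds hy.1 hy.2), hmax hc⟩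

lemma exists_isLocalMin_Ioo {f : ℝ → ℝ} {a b c : ℝ} (hf : ContinuousOn f (Icc a b))
    (hc : c ∈ Icc a b) (ha : f c < f a) (hb : f c < f b) :
    ∃ y ∈ Ioo a b, IsLocalMin f y ∧ f y ≤ f c := by
  obtain ⟨y, hy, hmax, hle⟩ := exists_isLocalMax_Ioo hf.neg hc (neg_lt_neg ha) (neg_lt_neg hb)
  exact ⟨y, hy, by simpa using hmax.neg, neg_le_neg_iff.1 hle⟩

lemma exists_isLocalMax_isLocalMin_of_not_monotoneOn {f : ℝ → ℝ} {a b : ℝ}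
    (hf : ContinuousOn f (Icc a b)) (hmin : IsMinOn f (Icc a b) a) (hmax : IsMaxOn f (Icc a b) b)
    (h : ¬ MonotoneOn f (Icc a b)) :
    ∃ y z, a < y ∧ y < z ∧ z < b ∧ IsLocalMax f y ∧ IsLocalMin f z ∧ f a < f y ∧ f z < f b := by
  obtain ⟨u, hu, v, hv, huv, hlt⟩ : ∃ u ∈ Icc a b, ∃ v ∈ Icc a b, u ≤ v ∧ f v < f u := by
    simpa [MonotoneOn, and_assoc] using h
  have hav : f a ≤ f v := hmin hv
  have hub : f u ≤ f b := hmax hu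
  obtain ⟨y, hy, hymax, huy⟩ := exists_isLocalMax_Ioo (hf.mono (Icc_subset_Icc_right hv.2))
    ⟨hu.1, huv⟩ (hav.trans_lt hlt) hlt
  obtain ⟨z, hz, hzmin, hzv⟩ := exists_isLocalMin_Ioo (hf.mono (Icc_subset_Icc_left hy.1.le))
    ⟨hy.2.le, hv.2⟩ (hlt.trans_le huy) (hlt.trans_le hub)
  exact ⟨y, z, hy.1, hz.1, hz.2, hymax, hzmin, (hav.trans_lt hlt).trans_le huy,
    hzv.trans_lt (hlt.trans_le hub)⟩

lemma deriv_nonneg_of_monotoneOn {f : ℝ → ℝ} {s : Set ℝ} {x : ℝ} (h : MonotoneOn f s)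
    (hs : s ∈ 𝓝 x) : 0 ≤ deriv f x := by
  rw [← derivWithin_of_mem_nhds hs]
  exact h.derivWithin_nonneg

lemma deriv_nonpos_of_antitoneOn {f : ℝ → ℝ} {s : Set ℝ} {x : ℝ} (h : AntitoneOn f s)
    (hs : s ∈ 𝓝 x) : deriv f x ≤ 0 := by
  simpa using deriv_nonneg_of_monotoneOn h.neg hs

lemma mul_sub_pos_of_deriv_pos {f : ℝ → ℝ} {s : Set ℝ} {b : ℝ} (hs : IsPreconnected s)
    (hf : ContinuousOn f s) (h0 : ∀ x ∈ s, f x ≠ 0) (hbs : b ∈ closure s) (hb : f b = 0)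
    (hd : 0 < deriv f b) : ∀ x ∈ s, 0 < f x * (x - b) := by
  have hne : ∀ x ∈ s, f x * (x - b) ≠ 0 := fun x hx =>
    mul_ne_zero (h0 x hx) (sub_ne_zero.2 fun hxb => h0 x hx (hxb ▸ hb))
  obtain ⟨x₀, hx₀, hsign⟩ := ((mem_closure_iff_frequently.1 hbs).and_eventually
    (eventually_nhdsWithin_sign_eq_of_deriv_pos hd hb)).exists
  have hpos : 0 < f x₀ * (x₀ - b) := by
    refine (hne x₀ hx₀).symm.lt_of_le ?_
    rw [← sign_nonneg_iff (a := f x₀ * (x₀ - b)), sign_mul, hsign, ← sign_mul, sign_nonneg_iff]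
    exact mul_self_nonneg _
  intro x hx
  by_contra! hle
  obtain ⟨y, hy, hy0⟩ := hs.intermediate_value hx hx₀
    (hf.mul (continuousOn_id.sub continuousOn_const)) ⟨hle, hpos.le⟩
  exact hne y hy hy0

lemma exists_smul_eq_of_inner_quarterTurn_eq_zero {x d : Plane} (hd : d ≠ 0)
    (h : ⟪x, quarterTurn d⟫ = 0) : ∃ c : ℝ, x = c • d := by
  have hexp := eq_inner_smul_add_inner_smul (e := ‖d‖⁻¹ • d) (n := quarterTurn (‖d‖⁻¹ • d))
    (norm_smul_inv_norm hd) (by rw [norm_quarterTurn]; exact norm_smul_inv_norm hd)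
    (inner_quarterTurn_self _) x
  rw [map_smul, inner_smul_right x (quarterTurn d), h, mul_zero, zero_smul, add_zero,
    smul_smul] at hexp
  exact ⟨_, hexp⟩

lemma inner_sub_eq_zero_of_sbtw {E : Type*} [NormedAddCommGroup E] [InnerProductSpace ℝ E]
    {x y z m : E} (h : Sbtw ℝ x y z) (hx : ⟪x - y, m⟫ ≤ 0) (hz : ⟪z - y, m⟫ ≤ 0) :
    ⟪x - y, m⟫ = 0 ∧ ⟪z - y, m⟫ = 0 := by
  obtain ⟨θ, hθ, hy⟩ := (sbtw_iff_mem_image_Ioo_and_ne.1 h).1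
  have hcomb : (1 - θ) • (x - y) + θ • (z - y) = 0 := by
    rw [AffineMap.lineMap_apply_module] at hy
    rw [← hy]
    module
  have hsum := congrArg (fun v => ⟪v, m⟫) hcomb
  simp only [inner_add_left, inner_smul_left, inner_zero_left, conj_trivial] at hsum
  constructor <;> nlinarith [hθ.1, hθ.2]

namespace BoundaryFrame

variable {S : Set Plane} {L : ℝ} {γ T ν : ℝ → Plane} {κ : ℝ → ℝ} {a b c p q : ℝ}

lemma exists_deriv_pos (F : BoundaryFrame S L γ T ν κ) (hab : a < b) (h : κ a < κ b) :
    ∃ u ∈ Ioo a b, κ u ≠ 0 ∧ 0 < deriv κ u := by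
  have hderiv : ∀ u, HasDerivAt (fun u => κ u ^ 2) (2 * κ u * deriv κ u) u := fun u =>
    ((F.hasDerivAt_curv u).pow 2).congr_deriv (by push_cast; ring)
  obtain ⟨u, hu, hslope⟩ := exists_hasDerivAt_eq_slope (fun u => κ u ^ 2) _ hab
    (F.continuous_curv.pow 2).continuousOn fun u _ => hderiv u
  have hpos : 0 < 2 * κ u * deriv κ u := hslope ▸ div_pos
    (sub_pos.2 (pow_lt_pow_left₀ h (F.curv_nonneg a) two_ne_zero)) (sub_pos.2 hab)
  refine ⟨u, hu, fun h0 => ?_,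
    pos_of_mul_pos_right hpos (mul_nonneg zero_le_two (F.curv_nonneg u))⟩
  rw [h0, mul_zero, zero_mul] at hpos
  exact hpos.false

lemma exists_deriv_neg (F : BoundaryFrame S L γ T ν κ) (hab : a < b) (h : κ b < κ a) :
    ∃ u ∈ Ioo a b, κ u ≠ 0 ∧ deriv κ u < 0 := by
  obtain ⟨u, hu, hu0, hderiv⟩ := F.reverse.exists_deriv_pos (neg_lt_neg hab) (by simpa using h)
  rw [deriv_comp_neg, neg_pos] at hderiv
  exact ⟨-u, ⟨by linarith [hu.2], by linarith [hu.1]⟩, hu0, hderiv⟩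

lemma inner_neg_of_curve_ne (F : BoundaryFrame S L γ T ν κ) (hκ : κ a ≠ 0) (h : γ b ≠ γ a) :
    ⟪γ b - γ a, ν a⟫ < 0 := by
  obtain ⟨u, hu, hub⟩ := F.exists_mem_Ico (F.curve_mem_frontier b) a
  rw [← hub] at h ⊢
  exact F.inner_neg_of_curv_ne_zero hκ (hu.1.lt_of_ne fun hau => h (by rw [hau])) hu.2

lemma normal_eq_of_inner_eq_zero (F : BoundaryFrame S L γ T ν κ)
    (h : ⟪γ a - γ b, ν b⟫ = 0) : ν b = ν a := by
  refine F.eq_normal ⟨F.norm_normal b, fun y hy => ?_⟩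
  rw [← sub_sub_sub_cancel_right y (γ a) (γ b), inner_sub_left, h, sub_zero]
  exact F.support b y hy

lemma inner_ne_zero_of_curve_ne (F : BoundaryFrame S L γ T ν κ) (hκ : κ a ≠ 0) (h : γ b ≠ γ a) :
    ⟪γ a - γ b, ν b⟫ ≠ 0 := fun h0 => by
  have hneg := F.inner_neg_of_curve_ne hκ h
  rw [← F.normal_eq_of_inner_eq_zero h0, ← neg_sub, inner_neg_left, h0, neg_zero] at hneg
  exact hneg.false

lemma inner_eq_zero_of_sbtw (F : BoundaryFrame S L γ T ν κ) (h : Sbtw ℝ (γ a) (γ b) (γ c)) :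
    ⟪γ a - γ b, ν b⟫ = 0 ∧ ⟪γ c - γ b, ν b⟫ = 0 :=
  inner_sub_eq_zero_of_sbtw h (F.support b _ (F.curve_mem a)) (F.support b _ (F.curve_mem c))

lemma not_collinear (F : BoundaryFrame S L γ T ν κ) (hκ : κ b ≠ 0) (hab : γ a ≠ γ b)
    (hbc : γ b ≠ γ c) (hac : γ a ≠ γ c) : ¬ Collinear ℝ {γ a, γ b, γ c} := by
  intro hcol
  rcases hcol.wbtw_or_wbtw_or_wbtw with h | h | h
  · exact (F.inner_neg_of_curve_ne hκ hab).ne (F.inner_eq_zero_of_sbtw ⟨h, hab.symm, hbc⟩).1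
  · exact F.inner_ne_zero_of_curve_ne hκ hbc.symm
      (F.inner_eq_zero_of_sbtw ⟨h, hbc.symm, hac.symm⟩).1
  · exact F.inner_ne_zero_of_curve_ne hκ hab (F.inner_eq_zero_of_sbtw ⟨h, hac, hab⟩).2

lemma inner_quarterTurn_chord_ne_zero (F : BoundaryFrame S L γ T ν κ) (hκ : κ q ≠ 0)
    (hpq : γ p ≠ γ q) (hp : γ b ≠ γ p) (hq : γ b ≠ γ q) :
    ⟪γ b - γ p, quarterTurn (γ q - γ p)⟫ ≠ 0 := by
  intro h0
  obtain ⟨r, hr⟩ := exists_smul_eq_of_inner_quarterTurn_eq_zero (sub_ne_zero.2 hpq.symm) h0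
  refine F.not_collinear hκ hpq hq.symm hp.symm
    ((collinear_iff_of_mem (p₀ := γ p) (by simp)).2 ⟨γ q - γ p, ?_⟩)
  rintro x (rfl | rfl | rfl)
  · exact ⟨0, by simp⟩
  · exact ⟨1, by simp⟩
  · exact ⟨r, by rw [← hr, vadd_eq_add, sub_add_cancel]⟩

lemma inner_tangent_quarterTurn_chord_ne_zero (F : BoundaryFrame S L γ T ν κ) (hκ : κ q ≠ 0)
    (hpq : γ p ≠ γ q) : ⟪T q, quarterTurn (γ q - γ p)⟫ ≠ 0 := by
  intro h0
  obtain ⟨r, hr⟩ := exists_smul_eq_of_inner_quarterTurn_eq_zero (sub_ne_zero.2 hpq.symm) h0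
  have horth : r * ⟪γ q - γ p, ν q⟫ = 0 := by
    rw [← F.orth q, hr, inner_smul_left, conj_trivial]
  rcases mul_eq_zero.1 horth with hr0 | hchord
  · refine ne_zero_of_norm_ne_zero (F.norm_tangent q ▸ one_ne_zero) ?_
    rw [hr, hr0, zero_smul]
  · have hneg := F.inner_neg_of_curve_ne hκ hpq
    rw [← neg_sub, inner_neg_left, hchord, neg_zero] at hneg
    exact hneg.false

lemma exists_separating_chord (F : BoundaryFrame S L γ T ν κ) (hpq : p < q) (hqp : q < p + L)
    (hκ : κ q ≠ 0) : ∃ m : Plane, (∀ u ∈ Ioo p q, ⟪γ u - γ p, m⟫ < 0) ∧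
      ∀ u ∈ Ioo q (p + L), 0 < ⟪γ u - γ p, m⟫ := by
  have hne : γ p ≠ γ q := F.curve_ne p q hpq hqp
  set d := quarterTurn (γ q - γ p)
  have hT : ⟪T q, d⟫ ≠ 0 := F.inner_tangent_quarterTurn_chord_ne_zero hκ hne
  set m := ⟪T q, d⟫ • d
  have hderiv : ∀ u, HasDerivAt (fun u => ⟪γ u - γ p, m⟫) ⟪T u, m⟫ u :=
    F.hasDerivAt_inner_curve (γ p) m
  have hcont : Continuous fun u => ⟪γ u - γ p, m⟫ :=
    continuous_iff_continuousAt.2 fun u => (hderiv u).continuousAt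
  have hq : ⟪γ q - γ p, m⟫ = 0 := by
    rw [inner_smul_right, inner_quarterTurn_self, mul_zero]
  have hq' : 0 < deriv (fun u => ⟪γ u - γ p, m⟫) q := by
    rw [(hderiv q).deriv, inner_smul_right]
    exact mul_self_pos.2 hT
  have hleft : ∀ u ∈ Ioo p q, ⟪γ u - γ p, m⟫ ≠ 0 := fun u hu => by
    rw [inner_smul_right]
    exact mul_ne_zero hT (F.inner_quarterTurn_chord_ne_zero hκ hne
      (F.curve_ne p u hu.1 (by linarith [hu.2])).symm (F.curve_ne u q hu.2 (by linarith [hu.1])))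
  have hright : ∀ u ∈ Ioo q (p + L), ⟪γ u - γ p, m⟫ ≠ 0 := fun u hu => by
    rw [inner_smul_right]
    exact mul_ne_zero hT (F.inner_quarterTurn_chord_ne_zero hκ hne
      (F.periodic p ▸ F.curve_ne u (p + L) hu.2 (by linarith [hu.1]))
      (F.curve_ne q u hu.1 (by linarith [hu.2])).symm)
  refine ⟨m, fun u hu => ?_, fun u hu => ?_⟩
  · exact neg_of_mul_pos_left (mul_sub_pos_of_deriv_pos isPreconnected_Ioo hcont.continuousOn hleft
      (by rw [closure_Ioo hpq.ne]; exact right_mem_Icc.2 hpq.le) hq hq' u hu) (sub_neg.2 hu.2).le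
  · exact pos_of_mul_pos_left (mul_sub_pos_of_deriv_pos isPreconnected_Ioo hcont.continuousOn hright
      (by rw [closure_Ioo hqp.ne]; exact left_mem_Icc.2 hqp.le) hq hq' u hu) (sub_pos.2 hu.1).le

lemma hasDerivAt_curv_mul_inner_sub (F : BoundaryFrame S L γ T ν κ) (y m : Plane) (u : ℝ) :
    HasDerivAt (fun u => κ u * ⟪γ u - y, m⟫ - ⟪ν u, m⟫) (deriv κ u * ⟪γ u - y, m⟫) u :=
  (((F.hasDerivAt_curv u).mul (F.hasDerivAt_inner_curve y m u)).sub
    (F.hasDerivAt_inner_normal m u)).congr_deriv (by ring)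

-- The integral of `κ' ⟪γ - γ p, m⟫` over a period vanishes, but if `m` is normal to the chord from
-- `γ p` to `γ q`, then the integrand would have a constant sign.
theorem not_antitoneOn_of_monotoneOn (F : BoundaryFrame S L γ T ν κ) (hpq : p < q)
    (hqp : q < p + L) (hκ : κ p < κ q) (hmono : MonotoneOn κ (Icc p q)) :
    ¬ AntitoneOn κ (Icc q (p + L)) := by
  intro hanti
  obtain ⟨m, hneg, hpos⟩ :=
    F.exists_separating_chord hpq hqp ((F.curv_nonneg p).trans_lt hκ).ne'
  set Φ : ℝ → ℝ := fun u => κ u * ⟪γ u - γ p, m⟫ - ⟪ν u, m⟫ with hΦ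
  have hderiv : ∀ u, HasDerivAt Φ (deriv κ u * ⟪γ u - γ p, m⟫) u :=
    F.hasDerivAt_curv_mul_inner_sub (γ p) m
  have hantitone : ∀ x y, (∀ u ∈ Ioo x y, deriv κ u * ⟪γ u - γ p, m⟫ ≤ 0) →
      AntitoneOn Φ (Icc x y) := fun x y h =>
    antitoneOn_of_deriv_nonpos (convex_Icc x y)
      (continuous_iff_continuousAt.2 fun u => (hderiv u).continuousAt).continuousOn
      (fun u _ => (hderiv u).differentiableAt.differentiableWithinAt)
      (fun u hu => (hderiv u).deriv ▸ h u (by rwa [interior_Icc] at hu))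
  have hleft : AntitoneOn Φ (Icc p q) := hantitone p q fun u hu =>
    mul_nonpos_of_nonneg_of_nonpos
      (deriv_nonneg_of_monotoneOn hmono (Icc_mem_nhds hu.1 hu.2)) (hneg u hu).le
  have hright : AntitoneOn Φ (Icc q (p + L)) := hantitone q (p + L) fun u hu =>
    mul_nonpos_of_nonpos_of_nonneg
      (deriv_nonpos_of_antitoneOn hanti (Icc_mem_nhds hu.1 hu.2)) (hpos u hu).le
  have hperiod : Φ p ≤ Φ q := by
    have hle := hright (left_mem_Icc.2 hqp.le) (right_mem_Icc.2 hqp.le) hqp.le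
    simpa only [hΦ, F.periodic p, F.periodic_normal p, F.periodic_curv p] using hle
  obtain ⟨u, hu, -, hκu⟩ := F.exists_deriv_pos hpq hκ
  have hconst : Φ =ᶠ[𝓝 u] fun _ => Φ p := by
    filter_upwards [Icc_mem_nhds hu.1 hu.2] with v hv
    exact (hleft (left_mem_Icc.2 hpq.le) hv hv.1).antisymm
      (hperiod.trans (hleft hv (right_mem_Icc.2 hpq.le) hv.2))
  exact (mul_neg_of_pos_of_neg hκu (hneg u hu)).ne
    (((hderiv u).congr_of_eventuallyEq hconst.symm).unique (hasDerivAt_const u (Φ p)))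

lemma inner_eq_zero_of_mem_flatPiece (F : BoundaryFrame S L γ T ν κ)
    (h : γ b ∈ flatPiece S (γ a)) : ⟪γ b - γ a, ν a⟫ = 0 := by
  obtain ⟨w, hw⟩ : midpoint ℝ (γ a) (γ b) ∈ range γ := by
    rw [F.range_eq]
    exact h (midpoint_mem_segment _ _)
  by_cases hab : γ a = γ b
  · rw [hab, sub_self, inner_zero_left]
  have hbtw : Sbtw ℝ (γ a) (γ w) (γ b) := by
    rw [hw]
    exact sbtw_midpoint_of_ne ℝ hab
  obtain ⟨ha, hb⟩ := F.inner_eq_zero_of_sbtw hbtw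
  rw [← F.normal_eq_of_inner_eq_zero ha, ← sub_sub_sub_cancel_right (γ b) (γ a) (γ w),
    inner_sub_left, ha, hb, sub_zero]

lemma disjoint_flatPiece (F : BoundaryFrame S L γ T ν κ) (hab : a < b) (hba : b < a + L)
    (hκ : ∃ u ∈ Icc a b, κ u ≠ 0) (hκ' : ∃ u ∈ Icc b (a + L), κ u ≠ 0) :
    Disjoint (flatPiece S (γ a)) (flatPiece S (γ b)) := by
  rw [Set.disjoint_left]
  intro z hza hzb
  obtain ⟨w, rfl⟩ : z ∈ range γ := F.range_eq ▸ hza (right_mem_segment ℝ _ z)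
  have ha := F.inner_eq_zero_of_mem_flatPiece hza
  have hb := F.inner_eq_zero_of_mem_flatPiece hzb
  rw [(F.normal_eq_of_inner_eq_zero hb).trans (F.normal_eq_of_inner_eq_zero ha).symm] at hb
  have hchord : ⟪γ b - γ a, ν a⟫ = 0 := by
    rw [← sub_sub_sub_cancel_left (γ a) (γ b) (γ w), inner_sub_left, ha, hb, sub_zero]
  obtain ⟨u, hu, hκu⟩ := hκ
  obtain ⟨v, hv, hκv⟩ := hκ'
  exact (F.curv_eq_zero_of_common_support hab hba hchord).elim (fun h => hκu (h u hu))
    fun h => hκv (h v hv)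

lemma disjoint_flatPiece_of_ne (F : BoundaryFrame S L γ T ν κ) {s : Fin 4 → ℝ} (hs : StrictMono s)
    (hL : s 3 < s 0 + L) (h₁ : κ (s 1) ≠ 0) (h₃ : κ (s 3) ≠ 0) {i j : Fin 4} (hij : i ≠ j) :
    Disjoint (flatPiece S (γ (s i))) (flatPiece S (γ (s j))) := by
  wlog hlt : i < j generalizing i j
  · exact (this hij.symm (hij.lt_or_gt.resolve_left hlt)).symm
  have hi : s 0 ≤ s i := hs.monotone (Fin.zero_le i)
  have hj : s j ≤ s 3 := hs.monotone (Fin.le_last j)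
  have hbetween : ∀ i j : Fin 4, i < j → i ≤ 1 ∧ 1 ≤ j ∨ i ≤ 3 ∧ 3 ≤ j := by decide
  refine F.disjoint_flatPiece (hs hlt) (by linarith) ?_ ⟨s 3, ⟨hj, by linarith⟩, h₃⟩
  rcases hbetween i j hlt with ⟨hi, hj⟩ | ⟨hi, hj⟩
  · exact ⟨s 1, ⟨hs.monotone hi, hs.monotone hj⟩, h₁⟩
  · exact ⟨s 3, ⟨hs.monotone hi, hs.monotone hj⟩, h₃⟩

lemma four_extrema_of_lt (F : BoundaryFrame S L γ T ν κ) {d : ℝ} (hab : a < b)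
    (hbc : b < c) (hcd : c < d) (hda : d < a + L) (hb : κ b ≠ 0) (hd : κ d ≠ 0)
    (ha' : IsLocalExtr κ a) (hb' : IsLocalExtr κ b) (hc' : IsLocalExtr κ c)
    (hd' : IsLocalExtr κ d) : ∃ s : Fin 4 → ℝ, (∀ i, IsLocalExtr κ (s i)) ∧
      ∀ i j, i ≠ j → Disjoint (flatPiece S (γ (s i))) (flatPiece S (γ (s j))) := by
  refine ⟨![a, b, c, d], fun i => by fin_cases i <;> assumption, fun i j hij =>
    F.disjoint_flatPiece_of_ne ?_ hda hb hd hij⟩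
  simp [hab, hbc, hcd]

lemma exists_isMin_isMax_curv (F : BoundaryFrame S L γ T ν κ) :
    ∃ p, ∃ q ∈ Icc p (p + L), ∀ u, κ p ≤ κ u ∧ κ u ≤ κ q := by
  have hL := F.L_pos
  obtain ⟨p, -, hp⟩ := isCompact_Icc.exists_isMinOn (nonempty_Icc.2 hL.le)
    F.continuous_curv.continuousOn
  obtain ⟨q, hq, hqmax⟩ := isCompact_Icc.exists_isMaxOn
    (nonempty_Icc.2 (le_add_of_nonneg_right hL.le : p ≤ p + L)) F.continuous_curv.continuousOn
  refine ⟨p, q, hq, fun u => ⟨?_, ?_⟩⟩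
  · obtain ⟨v, hv, huv⟩ := F.periodic_curv.exists_mem_Ico₀ hL u
    exact huv ▸ hp (Ico_subset_Icc_self hv)
  · obtain ⟨v, hv, huv⟩ := F.periodic_curv.exists_mem_Ico hL u p
    exact huv ▸ hqmax (Ico_subset_Icc_self hv)

lemma four_extrema_of_const_curv (F : BoundaryFrame S L γ T ν κ) (h : ∀ u v, κ u = κ v) :
    ∃ s : Fin 4 → ℝ, (∀ i, IsLocalExtr κ (s i)) ∧
      ∀ i j, i ≠ j → Disjoint (flatPiece S (γ (s i))) (flatPiece S (γ (s j))) := by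
  have hL := F.L_pos
  obtain ⟨v, hv⟩ := F.exists_curv_ne_zero
  have hne : ∀ u, κ u ≠ 0 := fun u => h u v ▸ hv
  have hext : ∀ u, IsLocalExtr κ u := fun u => Or.inl (Eventually.of_forall fun v => (h u v).le)
  exact F.four_extrema_of_lt (a := 0) (b := L / 4) (c := L / 2) (d := 3 * L / 4)
    (by linarith) (by linarith) (by linarith) (by linarith) (hne _) (hne _) (hext _) (hext _)
    (hext _) (hext _)

theorem exists_four_extrema (F : BoundaryFrame S L γ T ν κ) :
    ∃ s : Fin 4 → ℝ, (∀ i, IsLocalExtr κ (s i)) ∧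
      ∀ i j, i ≠ j → Disjoint (flatPiece S (γ (s i))) (flatPiece S (γ (s j))) := by
  obtain ⟨p, q, hq, hpq⟩ := F.exists_isMin_isMax_curv
  have hp : IsLocalExtr κ p := Or.inl (Eventually.of_forall fun u => (hpq u).1)
  have hq' : IsLocalExtr κ q := Or.inr (Eventually.of_forall fun u => (hpq u).2)
  have hκ := F.continuous_curv
  have hper := F.periodic_curv p
  have hp0 := F.curv_nonneg p
  rcases (hpq q).1.eq_or_lt with heq | hlt
  · have hconst : ∀ u, κ u = κ p := fun u => ((hpq u).2.trans_eq heq.symm).antisymm (hpq u).1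
    exact F.four_extrema_of_const_curv fun u v => (hconst u).trans (hconst v).symm
  have hpq' : p < q := hq.1.lt_of_ne fun h => hlt.ne (by rw [h])
  have hqp : q < p + L := hq.2.lt_of_ne fun h => hlt.ne' (by rw [h, hper])
  by_cases hmono : MonotoneOn κ (Icc p q)
  · have hanti : ¬ MonotoneOn (-κ) (Icc q (p + L)) := fun h =>
      F.not_antitoneOn_of_monotoneOn hpq' hqp hlt hmono (by simpa using h.neg)
    obtain ⟨y, z, hqy, hyz, hz, hymax, hzmin, -, hκz⟩ :=
      exists_isLocalMax_isLocalMin_of_not_monotoneOn hκ.neg.continuousOn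
        (fun u _ => neg_le_neg (hpq u).2) (fun u _ => neg_le_neg (hper ▸ (hpq u).1)) hanti
    have hz0 : κ p < κ z := hper ▸ neg_lt_neg_iff.1 hκz
    have hymin : IsLocalMin κ y := by simpa using hymax.neg
    have hzmax : IsLocalMax κ z := by simpa using hzmin.neg
    exact F.four_extrema_of_lt hpq' hqy hyz hz (hp0.trans_lt hlt).ne' (hp0.trans_lt hz0).ne'
      hp hq' (Or.inl hymin) (Or.inr hzmax)
  · obtain ⟨y, z, hpy, hyz, hzq, hymax, hzmin, hκy, -⟩ :=
      exists_isLocalMax_isLocalMin_of_not_monotoneOn hκ.continuousOn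
        (fun u _ => (hpq u).1) (fun u _ => (hpq u).2) hmono
    exact F.four_extrema_of_lt hpy hyz hzq hqp (hp0.trans_lt hκy).ne' (hp0.trans_lt hlt).ne'
      hp (Or.inr hymax) (Or.inl hzmin) hq'

end BoundaryFrame

end FourVertices

section LocalFamilies

/-! ### Local families of fixed points -/

namespace IsLocalFixedFamily

variable {S U V : Set Plane} {C : Set (Plane × Plane)}

lemma mono (h : IsLocalFixedFamily S U C) (hUV : U ⊆ V) : IsLocalFixedFamily S V C :=
  ⟨h.1, fun z hz => hUV (h.2.1 z hz), h.2.2⟩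

lemma not_countable (h : IsLocalFixedFamily S U C) : ¬ (exteriorFixedPoints S).Countable := by
  obtain ⟨hC, -, -, δ, hδ, hlevel⟩ := h
  intro hcount
  have himage : Ioo 0 δ ⊆ (fun z => infDist z.1 S) '' C := hlevel
  exact hδ.not_ge (Cardinal.Real.Ioo_countable_iff.1 (((hcount.mono hC).image _).mono himage))

end IsLocalFixedFamily

lemma isCompact_flatPiece {S : Set Plane} (hS : IsCompact S) (x : Plane) :
    IsCompact (flatPiece S x) := by
  have hinter : flatPiece S x = ⋂ θ ∈ Icc (0 : ℝ) 1, {y | x + θ • (y - x) ∈ frontier S} := by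
    ext y
    simp only [flatPiece, mem_ofPred_eq, segment_eq_image', image_subset_iff, mem_iInter]
    rfl
  refine hS.of_isClosed_subset ?_ fun y hy =>
    hS.isClosed.frontier_subset (hy (right_mem_segment ℝ x y))
  rw [hinter]
  exact isClosed_biInter fun θ _ => isClosed_frontier.preimage (by fun_prop)

namespace BoundaryFrame

variable {S A U : Set Plane} {L : ℝ} {γ T ν : ℝ → Plane} {κ : ℝ → ℝ} {a b s u t α β ε : ℝ}

lemma isLocalFixedFamily_image (F : BoundaryFrame S L γ T ν κ) {e : ℝ → Plane} {C : Set (ℝ × ℝ)}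
    {δ : ℝ} (he : ∀ u, ContactFrame S (γ u) (e u) (ν u)) (hδ : 0 < δ) (hC : IsConnected C)
    (hpos : ∀ z ∈ C, 0 < z.2)
    (heq : ∀ z ∈ C, upperSlope S (γ z.1) (e z.1) (ν z.1) z.2 =
      upperSlope S (γ z.1) (-e z.1) (ν z.1) z.2)
    (hU : ∀ z ∈ C, γ z.1 + z.2 • ν z.1 ∈ U) (hlevel : ∀ t ∈ Ioo 0 δ, ∃ z ∈ C, z.2 = t) :
    IsLocalFixedFamily S U ((fun z : ℝ × ℝ => (γ z.1 + z.2 • ν z.1, -ν z.1)) '' C) := by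
  have hγ := F.continuous_curve
  have hν := F.continuous_normal
  refine ⟨?_, forall_mem_image.2 hU, hC.image _ (by fun_prop), δ, hδ, fun t ht => ?_⟩
  · rintro _ ⟨z, hz, rfl⟩
    exact (he z.1).mem_exteriorFixedPoints F.compact F.int (fun m => F.eq_normal)
      (hpos z hz) (heq z hz)
  · obtain ⟨z, hz, rfl⟩ := hlevel t ht
    exact ⟨_, mem_image_of_mem _ hz, (he z.1).infDist_eq (hpos z hz)⟩

lemma offset_mem_thickening (F : BoundaryFrame S L γ T ν κ) (ha : γ a ∈ A)
    (hu : |u - a| < ε / 2) (ht : t ∈ Ioo 0 (ε / 2)) : γ u + t • ν u ∈ thickening ε A := by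
  refine mem_thickening_iff.2 ⟨γ a, ha, ?_⟩
  calc dist (γ u + t • ν u) (γ a) = ‖(γ u - γ a) + t • ν u‖ := by
        rw [dist_eq_norm, add_sub_right_comm]
    _ ≤ ‖γ u - γ a‖ + ‖t • ν u‖ := norm_add_le _ _
    _ ≤ |u - a| + t := by
        rw [norm_smul, F.norm_normal, mul_one, Real.norm_of_nonneg ht.1.le]
        gcongr
        exact F.norm_curve_sub_le a u
    _ < ε := by linarith [ht.2]

lemma eventually_offset_mem_thickening (F : BoundaryFrame S L γ T ν κ) (hε : 0 < ε) (hαβ : α ≤ β)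
    (hA : ∀ u ∈ Icc α β, γ u ∈ A) (ha : α - ε / 2 < a) (hb : b < β + ε / 2) :
    ∀ᶠ t in 𝓝[>] (0 : ℝ), ∀ u ∈ Icc a b, γ u + t • ν u ∈ thickening ε A := by
  filter_upwards [Ioo_mem_nhdsGT (half_pos hε)] with t ht u hu
  have hproj : |u - projIcc α β hαβ u| < ε / 2 := by
    rw [coe_projIcc, abs_lt]
    grind [hu.1, hu.2]
  exact F.offset_mem_thickening (hA _ (projIcc α β hαβ u).2) hproj ht

lemma exists_isLocalFixedFamily_of_crossing (F : BoundaryFrame S L γ T ν κ) {e : ℝ → Plane}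
    (he : ∀ u, ContactFrame S (γ u) (e u) (ν u)) (hcont : Continuous e) (hab : a ≤ b)
    (hU : ∀ᶠ t in 𝓝[>] (0 : ℝ), ∀ u ∈ Icc a b, γ u + t • ν u ∈ U)
    (ha : ∀ᶠ t in 𝓝[>] 0, upperSlope S (γ a) (e a) (ν a) t < upperSlope S (γ a) (-e a) (ν a) t)
    (hb : ∀ᶠ t in 𝓝[>] 0, upperSlope S (γ b) (-e b) (ν b) t < upperSlope S (γ b) (e b) (ν b) t) :
    ∃ C, IsLocalFixedFamily S U C := by
  obtain ⟨δ, hδ, hsub⟩ := mem_nhdsGT_iff_exists_Ioc_subset.1 (hU.and (ha.and hb))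
  have hdiff := (F.continuousOn_upperSlope hcont).sub (F.continuousOn_upperSlope hcont.neg)
  obtain ⟨C, hC, hzero, hconn, hlevel⟩ := exists_connected_zeros_crossing hab hδ
    (hdiff.mono (prod_mono (subset_univ _) Ioc_subset_Ioi_self))
    (fun t ht => sub_neg.2 (hsub ht).2.1) (fun t ht => sub_pos.2 (hsub ht).2.2)
  exact ⟨_, F.isLocalFixedFamily_image he hδ hconn (fun z hz => (hC hz).2.1)
    (fun z hz => sub_eq_zero.1 (hzero z hz)) (fun z hz => (hsub (hC hz).2).1 _ (hC hz).1)
    (fun t ht => hlevel t (Ioo_subset_Ioc_self ht))⟩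

lemma exists_isLocalFixedFamily_of_valley (F : BoundaryFrame S L γ T ν κ) (hε : 0 < ε)
    (hαβ : α ≤ β) (hA : ∀ u ∈ Icc α β, γ u ∈ A) (hα : ∃ᶠ u in 𝓝[<] α, κ α < κ u)
    (hβ : ∃ᶠ u in 𝓝[>] β, κ β < κ u) : ∃ C, IsLocalFixedFamily S (thickening ε A) C := by
  obtain ⟨a₀, ha₀, hκa₀⟩ := (nhdsLT_basis α).frequently_iff.1 hα _ (sub_lt_self α (half_pos hε))
  obtain ⟨b₀, hb₀, hκb₀⟩ := (nhdsGT_basis β).frequently_iff.1 hβ _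
    (lt_add_of_pos_right β (half_pos hε))
  obtain ⟨a, ha, hκa, hda⟩ := F.exists_deriv_neg ha₀.2 hκa₀
  obtain ⟨b, hb, hκb, hdb⟩ := F.exists_deriv_pos hb₀.1 hκb₀
  exact F.exists_isLocalFixedFamily_of_crossing (fun u => (F.contactFrame u).neg)
    F.continuous_tangent.neg (ha.2.le.trans (hαβ.trans hb.1.le))
    (F.eventually_offset_mem_thickening hε hαβ hA (ha₀.1.trans ha.1) (hb.2.trans hb₀.2))
    (by simpa using F.eventually_upperSlope_gt hκa hda)
    (by simpa using F.eventually_upperSlope_lt hκb hdb)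

lemma exists_isLocalFixedFamily_of_peak (F : BoundaryFrame S L γ T ν κ) (hε : 0 < ε)
    (hαβ : α ≤ β) (hA : ∀ u ∈ Icc α β, γ u ∈ A) (hα : ∃ᶠ u in 𝓝[<] α, κ u < κ α)
    (hβ : ∃ᶠ u in 𝓝[>] β, κ u < κ β) : ∃ C, IsLocalFixedFamily S (thickening ε A) C := by
  obtain ⟨a₀, ha₀, hκa₀⟩ := (nhdsLT_basis α).frequently_iff.1 hα _ (sub_lt_self α (half_pos hε))
  obtain ⟨b₀, hb₀, hκb₀⟩ := (nhdsGT_basis β).frequently_iff.1 hβ _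
    (lt_add_of_pos_right β (half_pos hε))
  obtain ⟨a, ha, hκa, hda⟩ := F.exists_deriv_pos ha₀.2 hκa₀
  obtain ⟨b, hb, hκb, hdb⟩ := F.exists_deriv_neg hb₀.1 hκb₀
  exact F.exists_isLocalFixedFamily_of_crossing F.contactFrame F.continuous_tangent
    (ha.2.le.trans (hαβ.trans hb.1.le))
    (F.eventually_offset_mem_thickening hε hαβ hA (ha₀.1.trans ha.1) (hb.2.trans hb₀.2))
    (F.eventually_upperSlope_lt hκa hda) (F.eventually_upperSlope_gt hκb hdb)

lemma exists_isLocalFixedFamily_of_circularArc (F : BoundaryFrame S L γ T ν κ) {k : ℝ} (hk : k ≠ 0)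
    (hs : γ s ∈ A) (hu : |u - s| < ε / 2) (hκ : ∀ᶠ v in 𝓝 u, κ v = k) :
    ∃ C, IsLocalFixedFamily S (thickening ε A) C := by
  obtain ⟨η, hη, hball⟩ := Metric.eventually_nhds_iff_ball.1 hκ
  rw [Real.ball_eq_Ioo] at hball
  obtain ⟨δ, hδ, hsub⟩ := mem_nhdsGT_iff_exists_Ioo_subset.1
    ((F.eventually_upperSlope_eq_of_const_curv hk hη hball).and
      (Ioo_mem_nhdsGT ((abs_nonneg _).trans_lt hu)))
  refine ⟨_, F.isLocalFixedFamily_image (C := {u} ×ˢ Ioo 0 δ) F.contactFrame hδ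
    (isConnected_singleton.prod (isConnected_Ioo hδ)) (fun z hz => hz.2.1) ?_ ?_
    fun t ht => ⟨(u, t), ⟨rfl, ht⟩, rfl⟩⟩
  · rintro ⟨v, t⟩ ⟨rfl, ht⟩
    exact (hsub ht).1
  · rintro ⟨v, t⟩ ⟨rfl, ht⟩
    exact F.offset_mem_thickening hs hu (hsub ht).2

lemma exists_isLocalFixedFamily_of_eventually_const (F : BoundaryFrame S L γ T ν κ) {I : Set ℝ}
    (hI : IsOpen I) [(𝓝[I] s).NeBot] (hε : 0 < ε) (hs : γ s ∈ A) (hκs : κ s ≠ 0)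
    (hκ : ∀ᶠ u in 𝓝[I] s, κ u = κ s) : ∃ C, IsLocalFixedFamily S (thickening ε A) C := by
  have hnear : ∀ᶠ u in 𝓝[I] s, |u - s| < ε / 2 :=
    eventually_nhdsWithin_of_eventually_nhds (Metric.ball_mem_nhds s (half_pos hε))
  obtain ⟨u, ⟨hu, hconst⟩, huI⟩ :=
    ((hnear.and (eventually_eventually_nhdsWithin.2 hκ)).and self_mem_nhdsWithin).exists
  rw [hI.nhdsWithin_eq huI] at hconst
  exact F.exists_isLocalFixedFamily_of_circularArc hκs hs hu hconst

lemma exists_right_end_of_flat_arc (F : BoundaryFrame S L γ T ν κ) (hs : κ s = 0) :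
    ∃ β, s ≤ β ∧ (∀ u ∈ Icc s β, κ u = 0) ∧ ∃ᶠ u in 𝓝[>] β, κ u ≠ 0 := by
  obtain ⟨v, hv⟩ := F.exists_curv_ne_zero
  obtain ⟨w, hw, hvw⟩ := F.periodic_curv.exists_mem_Ico F.L_pos v s
  set K : Set ℝ := {u | s ≤ u ∧ κ u ≠ 0}
  have hKne : K.Nonempty := ⟨w, hw.1, hvw ▸ hv⟩
  have hKbdd : BddBelow K := ⟨s, fun u hu => hu.1⟩
  have hsβ : s ≤ sInf K := le_csInf hKne fun u hu => hu.1
  have hIco : ∀ u ∈ Ico s (sInf K), κ u = 0 := fun u hu =>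
    by_contra fun hne => notMem_of_lt_csInf hu.2 hKbdd ⟨hu.1, hne⟩
  have hIcc : ∀ u ∈ Icc s (sInf K), κ u = 0 := by
    rcases hsβ.eq_or_lt with heq | hlt
    · rw [← heq, Icc_self]
      exact fun u hu => hu ▸ hs
    · rw [← closure_Ico hlt.ne]
      exact closure_minimal hIco (isClosed_eq F.continuous_curv continuous_const)
  refine ⟨sInf K, hsβ, hIcc, (nhdsGT_basis _).frequently_iff.2 fun c hc => ?_⟩
  obtain ⟨u, hu, huc⟩ := exists_lt_of_csInf_lt hKne hc
  exact ⟨u, ⟨lt_of_not_ge fun hle => hu.2 (hIcc u ⟨hu.1, hle⟩), huc⟩, hu.2⟩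

lemma exists_left_end_of_flat_arc (F : BoundaryFrame S L γ T ν κ) (hs : κ s = 0) :
    ∃ α ≤ s, (∀ u ∈ Icc α s, κ u = 0) ∧ ∃ᶠ u in 𝓝[<] α, κ u ≠ 0 := by
  obtain ⟨β, hsβ, hflat, hfreq⟩ := F.reverse.exists_right_end_of_flat_arc (s := -s) (by simpa)
  refine ⟨-β, by linarith, fun u hu => ?_, ?_⟩
  · simpa using hflat (-u) ⟨by linarith [hu.2], by linarith [hu.1]⟩
  · exact tendsto_neg_nhdsGT.frequently hfreq

lemma exists_isLocalFixedFamily_of_curv_eq_zero (F : BoundaryFrame S L γ T ν κ) (hs : κ s = 0)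
    (hε : 0 < ε) : ∃ C, IsLocalFixedFamily S (thickening ε (flatPiece S (γ s))) C := by
  obtain ⟨β, hsβ, hright, hβ⟩ := F.exists_right_end_of_flat_arc hs
  obtain ⟨α, hαs, hleft, hα⟩ := F.exists_left_end_of_flat_arc hs
  have hflat : ∀ u ∈ Icc α β, κ u = 0 := fun u hu =>
    (le_total u s).elim (fun h => hleft u ⟨hu.1, h⟩) (fun h => hright u ⟨h, hu.2⟩)
  have hzero : κ α = 0 ∧ κ β = 0 := ⟨hleft α ⟨le_rfl, hαs⟩, hright β ⟨hsβ, le_rfl⟩⟩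
  have hpos : ∀ u, κ u ≠ 0 → 0 < κ u := fun u hu => (F.curv_nonneg u).lt_of_ne' hu
  refine F.exists_isLocalFixedFamily_of_valley hε (hαs.trans hsβ) (fun u hu => ?_)
    (hα.mono (by rwa [hzero.1])) (hβ.mono (by rwa [hzero.2]))
  exact F.mem_flatPiece_of_curv_eq_zero fun v hv =>
    hflat v (uIcc_subset_Icc ⟨hαs, hsβ⟩ hu hv)

theorem exists_isLocalFixedFamily_of_isLocalExtr (F : BoundaryFrame S L γ T ν κ)
    (hs : IsLocalExtr κ s) (hε : 0 < ε) :
    ∃ C, IsLocalFixedFamily S (thickening ε (flatPiece S (γ s))) C := by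
  have hself : γ s ∈ flatPiece S (γ s) := by
    simpa [flatPiece] using F.curve_mem_frontier s
  have hpoint : ∀ u ∈ Icc s s, γ u ∈ flatPiece S (γ s) := by simpa using hself
  by_cases hκ : κ s = 0
  · exact F.exists_isLocalFixedFamily_of_curv_eq_zero hκ hε
  by_cases hleft : ∀ᶠ u in 𝓝[<] s, κ u = κ s
  · exact F.exists_isLocalFixedFamily_of_eventually_const isOpen_Iio hε hself hκ hleft
  by_cases hright : ∀ᶠ u in 𝓝[>] s, κ u = κ s
  · exact F.exists_isLocalFixedFamily_of_eventually_const isOpen_Ioi hε hself hκ hright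
  rcases hs with hmin | hmax
  · have hlt : ∀ {l : Filter ℝ}, l ≤ 𝓝 s → (¬ ∀ᶠ u in l, κ u = κ s) → ∃ᶠ u in l, κ s < κ u :=
      fun hl hne => ((not_eventually.1 hne).and_eventually (hl hmin)).mono
        fun u hu => hu.2.lt_of_ne' hu.1
    exact F.exists_isLocalFixedFamily_of_valley hε le_rfl hpoint (hlt inf_le_left hleft)
      (hlt inf_le_left hright)
  · have hlt : ∀ {l : Filter ℝ}, l ≤ 𝓝 s → (¬ ∀ᶠ u in l, κ u = κ s) → ∃ᶠ u in l, κ u < κ s :=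
      fun hl hne => ((not_eventually.1 hne).and_eventually (hl hmax)).mono
        fun u hu => hu.2.lt_of_ne hu.1
    exact F.exists_isLocalFixedFamily_of_peak hε le_rfl hpoint (hlt inf_le_left hleft)
      (hlt inf_le_left hright)

end BoundaryFrame

lemma exists_pairwise_disjoint_thickenings {X ι : Type*} [PseudoEMetricSpace X] [Finite ι]
    {K : ι → Set X} (hK : ∀ i, IsCompact (K i)) (hclosed : ∀ i, IsClosed (K i))
    (hdisj : ∀ i j, i ≠ j → Disjoint (K i) (K j)) {ε : ℝ} (hε : 0 < ε) :
    ∃ r ∈ Ioo 0 ε, ∀ i j, i ≠ j → Disjoint (thickening r (K i)) (thickening r (K j)) := by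
  have hsep : ∀ᶠ r in 𝓝[>] 0, ∀ i j, i ≠ j →
      Disjoint (thickening r (K i)) (thickening r (K j)) := by
    refine eventually_all.2 fun i => eventually_all.2 fun j => eventually_imp_distrib_left.2 ?_
    intro hij
    obtain ⟨δ, hδ, hthick⟩ := (hdisj i j hij).exists_thickenings (hK i) (hclosed j)
    filter_upwards [Ioo_mem_nhdsGT hδ] with r hr
    exact hthick.mono (thickening_mono hr.2.le _) (thickening_mono hr.2.le _)
  exact (Filter.Eventually.and (Ioo_mem_nhdsGT hε) hsep).exists

theorem BoundaryFrame.exists_disjoint_isLocalFixedFamily {S : Set Plane} {L : ℝ}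
    {γ T ν : ℝ → Plane} {κ : ℝ → ℝ} (F : BoundaryFrame S L γ T ν κ) {ι : Type*} [Finite ι]
    {s : ι → ℝ} (hs : ∀ i, IsLocalExtr κ (s i))
    (hdisj : ∀ i j, i ≠ j → Disjoint (flatPiece S (γ (s i))) (flatPiece S (γ (s j)))) {ε : ℝ}
    (hε : 0 < ε) : ∃ C : ι → Set (Plane × Plane),
      (∀ i, IsLocalFixedFamily S (thickening ε (flatPiece S (γ (s i)))) (C i)) ∧
      ∀ i j, i ≠ j → Disjoint (C i) (C j) := by
  have hcompact : ∀ i, IsCompact (flatPiece S (γ (s i))) := fun i =>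
    isCompact_flatPiece F.compact _
  obtain ⟨r, hr, hthick⟩ := exists_pairwise_disjoint_thickenings hcompact
    (fun i => (hcompact i).isClosed) hdisj hε
  choose C hC using fun i => F.exists_isLocalFixedFamily_of_isLocalExtr (hs i) hr.1
  refine ⟨C, fun i => (hC i).mono (thickening_mono hr.2.le _), fun i j hij => ?_⟩
  exact disjoint_left.2 fun z hzi hzj =>
    disjoint_left.1 (hthick i j hij) ((hC i).2.1 z hzi) ((hC j).2.1 z hzj)

end LocalFamilies

end

theorem theorem2p1 (S : Set Plane) (hconv : Convex ℝ S) (hcomp : IsCompact S)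
    (hint : (interior S).Nonempty) (L : ℝ) (γ : ℝ → Plane) (hγ : IsArcLengthBoundary S L γ) :
    -- there are uncountably many fixed points
    ¬ (exteriorFixedPoints S).Countable ∧
    -- a local one-parameter family of fixed points arises near every vertex
    (∀ s : ℝ, IsVertex γ s → ∀ ε : ℝ, 0 < ε →
      ∃ C : Set (Plane × Plane),
        IsLocalFixedFamily S (Metric.thickening ε (flatPiece S (γ s))) C) ∧
    -- there are at least four vertices, and they give four different families
    ∃ s : Fin 4 → ℝ, (∀ i, IsVertex γ (s i)) ∧
      (∀ i j, i ≠ j → Disjoint (flatPiece S (γ (s i))) (flatPiece S (γ (s j)))) ∧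
      ∀ ε : ℝ, 0 < ε → ∃ C : Fin 4 → Set (Plane × Plane),
        (∀ i, IsLocalFixedFamily S (Metric.thickening ε (flatPiece S (γ (s i)))) (C i)) ∧
        ∀ i j, i ≠ j → Disjoint (C i) (C j) := by
  obtain ⟨T, ν, κ, F⟩ := hγ.exists_boundaryFrame hconv hcomp hint
  simp only [IsVertex, F.curvature_eq]
  obtain ⟨s, hs, hdisj⟩ := F.exists_four_extrema
  refine ⟨?_, fun s hs ε hε => F.exists_isLocalFixedFamily_of_isLocalExtr hs hε, s, hs, hdisj,
    fun ε hε => F.exists_disjoint_isLocalFixedFamily hs hdisj hε⟩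
  obtain ⟨C, hC⟩ := F.exists_isLocalFixedFamily_of_isLocalExtr (hs 0) one_pos
  exact hC.not_countable
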